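/- **Lemma 4.1 (First order approximation).** Let $1\le r\le\min\{d_1,d_2\}$ and let $M=U\Lambda V^{\mathsf T}\in\mathbb R^{d_1\times d_2}$, where $U\in\mathbb R^{d_1\times r}$ and $V\in\mathbb R^{d_2\times r}$ satisfy $U^{\mathsf T}U=V^{\mathsf T}V=I_r$ and $\Lambda=\mathrm{diag}(\lambda_1,\dots,\lambda_r)$ with $\lambda_1\ge\dots\ge\lambda_r>0$. Let $Z\in\mathbb R^{d_1\times d_2}$ have i.i.d. $\mathcal N(0,1)$ entries and let $\hat U\in\mathbb R^{d_1\times r}$, $\hat V\in\mathbb R^{d_2\times r}$ be the (random) matrices of top-$r$ left and right singular vectors of $\hat M=M+Z$. Put $d_{\max}=\max\{d_1,d_2\}$, $d_\star=d_1+d_2-2r$ and $$\mathrm{dist}^2[(\hat U,\hat V),(U,V)]=\|\hat U\hat U^{\mathsf T}-UU^{\mathsf T}\|_{\rm F}^2+\|\hat V\hat V^{\mathsf T}-VV^{\mathsf T}\|_{\rm F}^2 .$$ Let $X=\begin{pmatrix}0&Z\\ Z^{\mathsf T}&0\end{pmatrix}$ and, for $1\le i\le r$, with $u_i,v_i$ the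 columns of $U,V$, let $\theta_{\pm i}=\frac1{\sqrt2}\begin{pmatrix}u_i\\ \pm v_i\end{pmatrix}$ and $\lambda_{-i}=-\lambda_i$. Let $\mathfrak P^{-1}=\sum_{1\le|j|\le r}\lambda_j^{-1}\theta_j\theta_j^{\mathsf T}$ and let $\mathfrak P^{\perp}=I-\sum_{1\le|j|\le r}\theta_j\theta_j^{\mathsf T}$ be the orthogonal projection onto the orthogonal complement of $\mathrm{span}\{\theta_j:1\le|j|\le r\}$. Then $$\mathbb E\|\mathfrak P^{\perp}X\mathfrak P^{-1}\|_{\rm F}^2=d_\star\|\Lambda^{-1}\|_{\rm F}^2 .$$ Moreover, there are absolute constants $C_1,C_2>0$ such that, whenever $\lambda_r\ge C_1\sqrt{d_{\max}}$, $$\Big|\mathbb E\,\mathrm{dist}^2[(\hat U,\hat V),(U,V)]-2d_\star\|\Lambda^{-1}\|_{\rm F}^2\Big|\le C_2\,r\Big(\frac{d_{\max}}{\lambda_r^2}\Big)^2 .$$ -/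

import Mathlib

open MeasureTheory ProbabilityTheory Matrix
open scoped Matrix.Norms.Frobenius

/-! With the scope opened above, `‖A‖` is the Frobenius norm of a real matrix `A`. -/

/-- `A = P diag(σ) Qᵀ` is a singular value decomposition of `A` with `k` terms: `P` and `Q` have
orthonormal columns and the numbers `σ` are nonnegative and non-increasing. -/
structure IsSVD {m n k : ℕ} (A : Matrix (Fin m) (Fin n) ℝ) (P : Matrix (Fin m) (Fin k) ℝ)
    (σ : Fin k → ℝ) (Q : Matrix (Fin n) (Fin k) ℝ) : Prop where
  left_orthonormal : Pᵀ * P = 1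
  right_orthonormal : Qᵀ * Q = 1
  nonneg : ∀ i, 0 ≤ σ i
  antitone : Antitone σ
  eq_mul : A = P * diagonal σ * Qᵀ

/-- The columns of `Uh` and `Vh` are top-`r` left and right singular vectors of `A`: they are the
first `r` columns of the two factors of some full singular value decomposition of `A`
(one with `min m n` terms). -/
def IsTopSingularVectors {m n r : ℕ} (A : Matrix (Fin m) (Fin n) ℝ)
    (Uh : Matrix (Fin m) (Fin r) ℝ) (Vh : Matrix (Fin n) (Fin r) ℝ) : Prop :=
  ∃ (h : r ≤ min m n) (P : Matrix (Fin m) (Fin (min m n)) ℝ) (σ : Fin (min m n) → ℝ)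
    (Q : Matrix (Fin n) (Fin (min m n)) ℝ),
    IsSVD A P σ Q ∧ Uh = P.submatrix id (Fin.castLE h) ∧ Vh = Q.submatrix id (Fin.castLE h)

/-- The entries of the random matrix `Z` are i.i.d. standard normal. -/
structure IsStdGaussianMatrix {Ω : Type*} [MeasurableSpace Ω] {m n : ℕ}
    (Z : Ω → Matrix (Fin m) (Fin n) ℝ) (μ : Measure Ω) : Prop where
  hasLaw : ∀ i j, HasLaw (fun ω => Z ω i j) (gaussianReal 0 1) μ
  indep : iIndepFun (fun (p : Fin m × Fin n) ω => Z ω p.1 p.2) μ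

/-- The squared projection distance `‖Uh Uhᵀ - U Uᵀ‖_F² + ‖Vh Vhᵀ - V Vᵀ‖_F²`. -/
noncomputable def distSq {m n r : ℕ} (Uh : Matrix (Fin m) (Fin r) ℝ) (Vh : Matrix (Fin n) (Fin r) ℝ)
    (U : Matrix (Fin m) (Fin r) ℝ) (V : Matrix (Fin n) (Fin r) ℝ) : ℝ :=
  ‖Uh * Uhᵀ - U * Uᵀ‖ ^ 2 + ‖Vh * Vhᵀ - V * Vᵀ‖ ^ 2

/-- The symmetric dilation `[[0, Z], [Zᵀ, 0]]`. -/
def symmDilation {m n : ℕ} (Z : Matrix (Fin m) (Fin n) ℝ) :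
    Matrix (Fin m ⊕ Fin n) (Fin m ⊕ Fin n) ℝ :=
  fromBlocks 0 Z Zᵀ 0

/-- The matrix `Θ` of eigenvectors of the dilation of `U Λ Vᵀ`: the column `Sum.inl i` is
`(u_i, v_i) / √2` (eigenvalue `λ_i`), the column `Sum.inr i` is `(u_i, -v_i) / √2`
(eigenvalue `-λ_i`). -/
noncomputable def thetaMat {m n r : ℕ} (U : Matrix (Fin m) (Fin r) ℝ)
    (V : Matrix (Fin n) (Fin r) ℝ) : Matrix (Fin m ⊕ Fin n) (Fin r ⊕ Fin r) ℝ :=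
  (Real.sqrt 2)⁻¹ • fromBlocks U U V (-V)

/-- `𝔓⁻¹`, the sum of `λ_j⁻¹ θ_j θ_jᵀ` over `1 ≤ |j| ≤ r`, where `λ_{-j} = -λ_j`. -/
noncomputable def projInv {m n r : ℕ} (U : Matrix (Fin m) (Fin r) ℝ)
    (V : Matrix (Fin n) (Fin r) ℝ) (lam : Fin r → ℝ) :
    Matrix (Fin m ⊕ Fin n) (Fin m ⊕ Fin n) ℝ :=
  thetaMat U V * diagonal (Sum.elim (fun i => (lam i)⁻¹) (fun i => (-lam i)⁻¹)) * (thetaMat U V)ᵀ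

/-- `𝔓^⊥`, the orthogonal projection onto the orthogonal complement of the span of the columns of
`Θ` (for `Θ` with orthonormal columns). -/
noncomputable def projPerp {m n r : ℕ} (U : Matrix (Fin m) (Fin r) ℝ)
    (V : Matrix (Fin n) (Fin r) ℝ) : Matrix (Fin m ⊕ Fin n) (Fin m ⊕ Fin n) ℝ :=
  1 - thetaMat U V * (thetaMat U V)ᵀ

/-- `𝔓^⊥ = Θp Θpᵀ` whenever `(Θ, Θp)` is an orthogonal matrix. -/
theorem projPerp_eq {m n r : ℕ} {ι : Type*} [Fintype ι] (U : Matrix (Fin m) (Fin r) ℝ)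
    (V : Matrix (Fin n) (Fin r) ℝ) (Θp : Matrix (Fin m ⊕ Fin n) ι ℝ)
    (h : fromCols (thetaMat U V) Θp * (fromCols (thetaMat U V) Θp)ᵀ = 1) :
    projPerp U V = Θp * Θpᵀ := by
  rw [transpose_fromCols, fromCols_mul_fromRows] at h
  rw [projPerp, ← h, add_sub_cancel_left]

/-! Pass to the symmetric dilation. The columns of `thetaMat U V` are eigenvectors of the dilation
of `M`, and `Θ Θᵀ` is block diagonal with blocks `U Uᵀ` and `V Vᵀ`. So `distSq` is the squared
Frobenius distance between two spectral projections `P` and `Ph` of symmetric matrices `A` and `A +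
X` (`distSq_eq_thetaMat`).

For such projections of equal rank, `‖Ph - P‖² = 2 ‖(1 - P) Ph‖²`, and `(1 - P) Ph = (1 - P) X B`
exactly, where `B` inverts `A + X` on the range of `Ph`. Expanding `B` around the inverse `S` of `A`
gives a quadratic term `2 ‖(1 - P) X S‖²`, a cubic term that is odd in `X`, and a remainder of order
`r (‖Z‖ / λ_r)⁴` (`projection_expansion`). Weyl's inequalities supply its spectral hypotheses when
`‖Z‖ ≤ λ_r / 2`. When `‖Z‖` is larger, every term is already dominated by the remainder, so the
expansion holds for every `Z` and every choice of singular vectors (`distSq_expansion`), and no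
exceptional event has to be cut out.

Now take expectations. The quadratic term has an explicit mean, because `E ‖A Z B‖² = ‖A‖² ‖B‖²` for
constant `A`, `B` (`integral_frobenius_mul_mul_sq`). The cubic term has mean zero, because `Z` and
`-Z` have the same law. The remainder needs only `E ‖Z‖⁴ ≤ C d_max²`
(`integral_opNorm_pow_four_le`). This follows from an exponential moment, found by bounding a
supremum of convex functions by an average over unit balls instead of using a net. -/

/-! ### Frobenius and spectral norms. -/

section MatrixNorms

variable {m n l : Type*} [Fintype m] [Fintype n] [Fintype l]

/-- The squared Frobenius norm is the sum of the squared entries. -/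
theorem frobenius_sq_eq_sum (A : Matrix m n ℝ) : ‖A‖ ^ 2 = ∑ i, ∑ j, A i j ^ 2 := by
  rw [Matrix.frobenius_norm_def, ← Real.sqrt_eq_rpow, Real.sq_sqrt (by positivity)]
  simp

theorem frobenius_sq_eq_trace (A : Matrix m n ℝ) : ‖A‖ ^ 2 = trace (Aᵀ * A) := by
  rw [frobenius_sq_eq_sum, Finset.sum_comm]
  simp [trace, Matrix.mul_apply, sq]

theorem frobenius_add_sq (A B : Matrix m n ℝ) :
    ‖A + B‖ ^ 2 = ‖A‖ ^ 2 + 2 * trace (Aᵀ * B) + ‖B‖ ^ 2 := by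
  have h : trace (Bᵀ * A) = trace (Aᵀ * B) := by
    rw [← trace_transpose, transpose_mul, transpose_transpose]
  simp only [frobenius_sq_eq_trace, transpose_add, Matrix.add_mul, Matrix.mul_add, trace_add, h]
  ring

theorem frobenius_sub_sq (A B : Matrix m n ℝ) :
    ‖A - B‖ ^ 2 = ‖A‖ ^ 2 - 2 * trace (Aᵀ * B) + ‖B‖ ^ 2 := by
  rw [sub_eq_add_neg, frobenius_add_sq, norm_neg, Matrix.mul_neg, trace_neg]
  ring

/-- Cauchy–Schwarz, obtained by squaring the triangle inequality for `A + B` and `A - B`. -/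
theorem abs_trace_transpose_mul_le (A B : Matrix m n ℝ) :
    |trace (Aᵀ * B)| ≤ ‖A‖ * ‖B‖ := by
  have h1 := pow_le_pow_left₀ (norm_nonneg _) (norm_add_le A B) 2
  have h2 := pow_le_pow_left₀ (norm_nonneg _) (norm_sub_le A B) 2
  rw [frobenius_add_sq] at h1
  rw [frobenius_sub_sq] at h2
  rw [abs_le]
  constructor <;> nlinarith

/-- The spectral norm of a real matrix. -/
noncomputable def opNorm [DecidableEq n] (A : Matrix m n ℝ) : ℝ :=
  ‖LinearMap.toContinuousLinearMap (toEuclideanLin A)‖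

variable [DecidableEq n]

theorem opNorm_nonneg (A : Matrix m n ℝ) : 0 ≤ opNorm A := norm_nonneg _

theorem opNorm_add_le (A B : Matrix m n ℝ) : opNorm (A + B) ≤ opNorm A + opNorm B := by
  simp only [opNorm, map_add]; exact norm_add_le _ _

theorem opNorm_neg (A : Matrix m n ℝ) : opNorm (-A) = opNorm A := by
  simp only [opNorm, map_neg, norm_neg]

theorem opNorm_sub_le (A B : Matrix m n ℝ) : opNorm (A - B) ≤ opNorm A + opNorm B := by
  simp only [opNorm, map_sub]; exact norm_sub_le _ _

/-- The `l2_opNorm_*` lemmas concern a norm that unfolds to `opNorm`, so they apply although `‖·‖`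
here means the Frobenius norm. -/
theorem opNorm_mul_le [DecidableEq l] (A : Matrix m n ℝ) (B : Matrix n l ℝ) :
    opNorm (A * B) ≤ opNorm A * opNorm B := l2_opNorm_mul A B

theorem opNorm_transpose [DecidableEq m] (A : Matrix m n ℝ) : opNorm Aᵀ = opNorm A := by
  have := l2_opNorm_conjTranspose A
  rwa [conjTranspose_eq_transpose_of_trivial] at this

theorem opNorm_transpose_mul_self (A : Matrix m n ℝ) : opNorm (Aᵀ * A) = opNorm A * opNorm A := by
  have := l2_opNorm_conjTranspose_mul_self A
  rwa [conjTranspose_eq_transpose_of_trivial] at this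

theorem opNorm_diagonal_le (v : n → ℝ) {c : ℝ} (hc : 0 ≤ c) (hv : ∀ i, |v i| ≤ c) :
    opNorm (diagonal v) ≤ c :=
  (l2_opNorm_diagonal v).le.trans ((pi_norm_le_iff_of_nonneg hc).2 hv)

theorem opNorm_one_le : opNorm (1 : Matrix n n ℝ) ≤ 1 := by
  rw [← diagonal_one]; exact opNorm_diagonal_le _ zero_le_one (by simp)

theorem continuous_opNorm : Continuous (opNorm : Matrix m n ℝ → ℝ) := by
  have h : Continuous ((toEuclideanLin (𝕜 := ℝ) (m := m) (n := n)).trans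
      LinearMap.toContinuousLinearMap).toLinearMap :=
    LinearMap.continuous_of_finiteDimensional _
  exact h.norm

theorem mulVec_dotProduct_self_le (A : Matrix m n ℝ) (x : n → ℝ) :
    (A *ᵥ x) ⬝ᵥ (A *ᵥ x) ≤ opNorm A ^ 2 * (x ⬝ᵥ x) := by
  have h := l2_opNorm_mulVec A (WithLp.toLp 2 x)
  have h2 := pow_le_pow_left₀ (norm_nonneg _) h 2
  rw [mul_pow, EuclideanSpace.real_norm_sq_eq, EuclideanSpace.real_norm_sq_eq] at h2
  simpa [dotProduct, sq, opNorm, l2_opNorm_def] using h2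

theorem opNorm_le_of_dotProduct_le (A : Matrix m n ℝ) {c : ℝ} (hc : 0 ≤ c)
    (h : ∀ x : n → ℝ, (A *ᵥ x) ⬝ᵥ (A *ᵥ x) ≤ c ^ 2 * (x ⬝ᵥ x)) : opNorm A ≤ c := by
  refine ContinuousLinearMap.opNorm_le_bound _ hc fun x => ?_
  refine (sq_le_sq₀ (norm_nonneg _) (by positivity)).1 ?_
  rw [mul_pow, EuclideanSpace.real_norm_sq_eq, EuclideanSpace.real_norm_sq_eq]
  simpa [dotProduct, sq] using h x.ofLp

/-- The spectral bound is applied to each column of `B`, and the squares are summed. -/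
theorem frobenius_mul_le_opNorm_mul (A : Matrix m n ℝ) (B : Matrix n l ℝ) :
    ‖A * B‖ ≤ opNorm A * ‖B‖ := by
  refine (sq_le_sq₀ (norm_nonneg _) (mul_nonneg (opNorm_nonneg _) (norm_nonneg _))).1 ?_
  rw [mul_pow, frobenius_sq_eq_sum, frobenius_sq_eq_sum, Finset.sum_comm,
    Finset.sum_comm (γ := n), Finset.mul_sum]
  refine Finset.sum_le_sum fun j _ => ?_
  have := mulVec_dotProduct_self_le A (fun k => B k j)
  simpa [dotProduct, mulVec, Matrix.mul_apply, sq] using this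

theorem frobenius_mul_le_mul_opNorm [DecidableEq m] (A : Matrix l m ℝ) (B : Matrix m n ℝ) :
    ‖A * B‖ ≤ ‖A‖ * opNorm B := by
  classical
  rw [← frobenius_norm_transpose, transpose_mul, ← frobenius_norm_transpose A, ← opNorm_transpose B,
    mul_comm ‖Aᵀ‖]
  exact frobenius_mul_le_opNorm_mul _ _

theorem opNorm_le_one_of_transpose_mul_self (A : Matrix m n ℝ) (h : Aᵀ * A = 1) :
    opNorm A ≤ 1 := by
  have h1 := opNorm_transpose_mul_self A
  rw [h] at h1
  have := opNorm_one_le (n := n)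
  nlinarith [opNorm_nonneg A]

theorem opNorm_le_one_of_projection (P : Matrix n n ℝ) (hs : Pᵀ = P) (hi : P * P = P) :
    opNorm P ≤ 1 := by
  have h1 := opNorm_transpose_mul_self P
  rw [hs, hi] at h1
  by_contra! hc
  nlinarith [opNorm_nonneg P]

theorem frobenius_diagonal_le (v : n → ℝ) {c : ℝ} (hc : 0 ≤ c) (hv : ∀ i, |v i| ≤ c) :
    ‖diagonal v‖ ≤ √(Fintype.card n) * c := by
  refine (sq_le_sq₀ (norm_nonneg _) (by positivity)).1 ?_
  rw [mul_pow, Real.sq_sqrt (by positivity), frobenius_norm_diagonal,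
    EuclideanSpace.real_norm_sq_eq]
  calc ∑ i, v i ^ 2 ≤ ∑ _i : n, c ^ 2 := Finset.sum_le_sum fun i _ => by
        rw [← sq_abs]; exact pow_le_pow_left₀ (abs_nonneg _) (hv i) 2
    _ = _ := by simp

end MatrixNorms

/-! ### Deterministic expansion of spectral projections. -/

section Perturbation

variable {ι : Type*} [Fintype ι] [DecidableEq ι]

theorem opNorm_mul_le_of_le {m n l : Type*} [Fintype m] [Fintype n] [Fintype l] [DecidableEq n]
    [DecidableEq l] {A : Matrix m n ℝ} {B : Matrix n l ℝ} {a b : ℝ} (hA : opNorm A ≤ a)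
    (hB : opNorm B ≤ b) : opNorm (A * B) ≤ a * b :=
  (opNorm_mul_le A B).trans
    (mul_le_mul hA hB (opNorm_nonneg _) ((opNorm_nonneg _).trans hA))

theorem frobenius_mul_le_of_opNorm_le {m n l : Type*} [Fintype m] [Fintype n] [Fintype l]
    [DecidableEq n] {A : Matrix m n ℝ} {B : Matrix n l ℝ} {a b : ℝ} (hA : opNorm A ≤ a)
    (hB : ‖B‖ ≤ b) : ‖A * B‖ ≤ a * b :=
  (frobenius_mul_le_opNorm_mul A B).trans
    (mul_le_mul hA hB (norm_nonneg _) ((opNorm_nonneg _).trans hA))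

/-- Equal traces make the two off-diagonal blocks `(1 - P) Ph` and `P (1 - Ph)` equally large, so
one of them suffices. -/
theorem projection_sub_sq (P Ph : Matrix ι ι ℝ) (hP : Pᵀ = P) (hPP : P * P = P)
    (hPh : Phᵀ = Ph) (hPhPh : Ph * Ph = Ph) (htr : trace P = trace Ph) :
    ‖Ph - P‖ ^ 2 = 2 * ‖(1 - P) * Ph‖ ^ 2 := by
  rw [frobenius_sq_eq_trace, frobenius_sq_eq_trace]
  have e1 : (Ph - P)ᵀ * (Ph - P) = Ph + P - Ph * P - P * Ph := by
    rw [transpose_sub, hP, hPh]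
    simp only [Matrix.sub_mul, Matrix.mul_sub, hPP, hPhPh]; abel
  have e2 : ((1 - P) * Ph)ᵀ * ((1 - P) * Ph) = Ph * Ph - Ph * P * Ph := by
    rw [transpose_mul, transpose_sub, hP, hPh, transpose_one]
    have : (1 - P) * (1 - P) = 1 - P := by
      simp only [Matrix.sub_mul, Matrix.mul_sub, hPP, Matrix.one_mul, Matrix.mul_one]; abel
    rw [Matrix.mul_assoc, ← Matrix.mul_assoc (1 - P), this]
    simp only [Matrix.sub_mul, Matrix.mul_sub, Matrix.one_mul, Matrix.mul_assoc]
  rw [e1, e2, hPhPh, trace_sub, trace_sub, trace_sub, trace_add, trace_mul_comm (Ph * P),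
    ← Matrix.mul_assoc, hPhPh, trace_mul_comm P, htr]
  ring

theorem frobenius_sq_eq_add_projection (Y P : Matrix ι ι ℝ) (hP : Pᵀ = P) (hPP : P * P = P) :
    ‖Y‖ ^ 2 = ‖Y * P‖ ^ 2 + ‖Y * (1 - P)‖ ^ 2 := by
  have h : Y = Y * P + Y * (1 - P) := by rw [← Matrix.mul_add]; simp
  conv_lhs => rw [h]
  have : trace ((Y * P)ᵀ * (Y * (1 - P))) = 0 := by
    rw [transpose_mul, hP, trace_mul_comm, Matrix.mul_assoc, ← Matrix.mul_assoc (1 - P)]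
    simp [Matrix.sub_mul, hPP]
  rw [frobenius_add_sq, this]; ring

/-- The third order term in the expansion of the squared distance of the projections. -/
noncomputable def cubicTerm (P S X : Matrix ι ι ℝ) : ℝ :=
  ‖(1 - P) * X * S + (1 - P) * X * ((1 - P) * X * (S * S) - S * X * S)‖ ^ 2
    - ‖(1 - P) * X * S - (1 - P) * X * ((1 - P) * X * (S * S) - S * X * S)‖ ^ 2

/-- The linear part `K` is odd in `X` and the quadratic part `C` is even, so changing the sign of
`X` exchanges `‖K + C‖` and `‖K - C‖`. Writing the cubic term as a difference of squares makes this
visible; it equals four times the inner product of `K` and `C`. -/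
theorem cubicTerm_neg (P S X : Matrix ι ι ℝ) : cubicTerm P S (-X) = -cubicTerm P S X := by
  unfold cubicTerm
  have h : (1 - P) * -X * ((1 - P) * -X * (S * S) - S * -X * S) =
      (1 - P) * X * ((1 - P) * X * (S * S) - S * X * S) := by
    simp only [Matrix.mul_neg, Matrix.neg_mul, Matrix.mul_sub]; abel
  rw [h, Matrix.mul_neg, Matrix.neg_mul, neg_sub]
  congr 2
  · rw [← norm_neg]; congr 1; abel
  · rw [← norm_neg]; congr 1; abel

theorem cubicTerm_eq (P S X : Matrix ι ι ℝ) : cubicTerm P S X =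
    4 * trace (((1 - P) * X * S)ᵀ * ((1 - P) * X * ((1 - P) * X * (S * S) - S * X * S))) := by
  rw [cubicTerm, frobenius_add_sq, frobenius_sub_sq]; ring

theorem opNorm_one_sub_projection_le (P : Matrix ι ι ℝ) (hP : Pᵀ = P) (hPP : P * P = P) :
    opNorm (1 - P) ≤ 1 := by
  refine opNorm_le_one_of_projection _ (by rw [transpose_sub, hP, transpose_one]) ?_
  simp only [Matrix.sub_mul, Matrix.mul_sub, hPP, Matrix.one_mul, Matrix.mul_one]; abel

/-- Size of the linear term of the expansion. -/
theorem frobenius_linear_le {P S X : Matrix ι ι ℝ} {x q s : ℝ} (hQ : opNorm (1 - P) ≤ 1)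
    (hX : opNorm X ≤ x) (hS : ‖S‖ ≤ s * q) : ‖(1 - P) * X * S‖ ≤ s * x * q :=
  (frobenius_mul_le_of_opNorm_le (opNorm_mul_le_of_le hQ hX) hS).trans (by linarith)

/-- Size of the quadratic term of the expansion. -/
theorem frobenius_quadratic_le {P S X : Matrix ι ι ℝ} {x q s : ℝ} (hQ : opNorm (1 - P) ≤ 1)
    (hX : opNorm X ≤ x) (hSo : opNorm S ≤ q) (hS : ‖S‖ ≤ s * q) :
    ‖(1 - P) * X * ((1 - P) * X * (S * S) - S * X * S)‖ ≤ 2 * s * x ^ 2 * q ^ 2 := by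
  have h1 : ‖(1 - P) * X * (S * S)‖ ≤ 1 * x * (q * (s * q)) :=
    frobenius_mul_le_of_opNorm_le (opNorm_mul_le_of_le hQ hX) (frobenius_mul_le_of_opNorm_le hSo hS)
  have h2 : ‖S * X * S‖ ≤ q * x * (s * q) :=
    frobenius_mul_le_of_opNorm_le (opNorm_mul_le_of_le hSo hX) hS
  refine (frobenius_mul_le_of_opNorm_le (opNorm_mul_le_of_le hQ hX)
    ((norm_sub_le _ _).trans (add_le_add h1 h2))).trans (by nlinarith)

theorem abs_cubicTerm_le {P S X : Matrix ι ι ℝ} {x q s : ℝ} (hQ : opNorm (1 - P) ≤ 1)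
    (hX : opNorm X ≤ x) (hSo : opNorm S ≤ q) (hS : ‖S‖ ≤ s * q) :
    |cubicTerm P S X| ≤ 8 * s ^ 2 * x ^ 3 * q ^ 3 := by
  have h1 := frobenius_linear_le hQ hX hS
  have h2 := frobenius_quadratic_le hQ hX hSo hS
  have h3 := abs_trace_transpose_mul_le ((1 - P) * X * S)
    ((1 - P) * X * ((1 - P) * X * (S * S) - S * X * S))
  have h4 := mul_le_mul h1 h2 (norm_nonneg _) ((norm_nonneg _).trans h1)
  rw [cubicTerm_eq, abs_mul, abs_of_nonneg (by norm_num : (0 : ℝ) ≤ 4)]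
  nlinarith

set_option maxHeartbeats 1000000 in
/-- Fourth order expansion of the distance of the spectral projections `P` of `A` and `Ph` of
`A + X`, where `S` and `B` are the inverses of `A` and `A + X` on the ranges of `P` and `Ph`. -/
theorem projection_expansion {A X P Ph S B : Matrix ι ι ℝ} {x q s : ℝ}
    (hx : 0 ≤ x) (hq : 0 ≤ q) (hs : 0 ≤ s) (hxq : x * q ≤ 1 / 2)
    (hP : Pᵀ = P) (hPP : P * P = P) (hPh : Phᵀ = Ph) (hPhPh : Ph * Ph = Ph)
    (htr : trace P = trace Ph) (hPA : P * A = A) (hAS : A * S = P)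
    (hPS : P * S = S) (hBA : B * (A + X) = Ph) (hAB : (A + X) * B = Ph)
    (hPhB : Ph * B = B) (hBT : Bᵀ = B) (hcomm : Ph * (A + X) = (A + X) * Ph)
    (hX : opNorm X ≤ x) (hSo : opNorm S ≤ q) (hS : ‖S‖ ≤ s * q) (hBo : opNorm B ≤ 2 * q)
    (hB : ‖B‖ ≤ 2 * s * q) (hrest : opNorm ((1 - Ph) * (A + X)) ≤ x) :
    |‖Ph - P‖ ^ 2 - 2 * ‖(1 - P) * X * S‖ ^ 2 - cubicTerm P S X| ≤ 250 * s ^ 2 * x ^ 4 * q ^ 4 := by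
  have hQo := opNorm_one_sub_projection_le P hP hPP
  have hQho := opNorm_one_sub_projection_le Ph hPh hPhPh
  have hQA : (1 - P) * A = 0 := by rw [Matrix.sub_mul, hPA, Matrix.one_mul, sub_self]
  have hQhQh : (1 - Ph) * (1 - Ph) = 1 - Ph := by
    simp only [Matrix.sub_mul, Matrix.mul_sub, hPhPh, Matrix.one_mul, Matrix.mul_one]; abel
  have hQhcomm : (1 - Ph) * (A + X) = (A + X) * (1 - Ph) := by
    rw [Matrix.sub_mul, Matrix.mul_sub, hcomm, Matrix.one_mul, Matrix.mul_one]
  -- The second factor `1 - Ph` is small on the range of `P`; it gains one order in the remainder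
  -- `R` below.
  have hrest' : (1 - Ph) * (A + X) = (1 - Ph) * (A + X) * (1 - Ph) := by
    rw [Matrix.mul_assoc, ← hQhcomm, ← Matrix.mul_assoc, hQhQh]
  -- the two off-diagonal products
  have hQhP : (1 - Ph) * P = (1 - Ph) * (A + X) * S - (1 - Ph) * X * S := by
    rw [← Matrix.sub_mul, ← Matrix.mul_sub, add_sub_cancel_right, Matrix.mul_assoc, hAS]
  have hQhPo : opNorm ((1 - Ph) * P) ≤ 2 * x * q := by
    rw [hQhP]
    refine (opNorm_sub_le _ _).trans ((add_le_add (opNorm_mul_le_of_le hrest hSo)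
      (opNorm_mul_le_of_le (opNorm_mul_le_of_le hQho hX) hSo)).trans (by linarith))
  have hPQho : opNorm (P * (1 - Ph)) ≤ 2 * x * q := by
    rw [← opNorm_transpose, transpose_mul, transpose_sub, hPh, hP, transpose_one]; exact hQhPo
  have hQPh : (1 - P) * Ph = (1 - P) * X * B := by
    rw [← hAB, ← Matrix.mul_assoc, Matrix.mul_add, hQA, zero_add]
  have hQPho : opNorm ((1 - P) * Ph) ≤ 2 * x * q := by
    rw [hQPh]
    exact (opNorm_mul_le_of_le (opNorm_mul_le_of_le hQo hX) hBo).trans (by linarith)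
  have hdiff : opNorm (P - Ph) ≤ 4 * x * q := by
    have : P - Ph = P * (1 - Ph) - (1 - P) * Ph := by
      simp only [Matrix.sub_mul, Matrix.mul_sub, Matrix.one_mul, Matrix.mul_one]; abel
    rw [this]
    exact (opNorm_sub_le _ _).trans (by linarith)
  have hQhS : (1 - Ph) * S = (1 - Ph) * P * S := by rw [Matrix.mul_assoc, hPS]
  have hQhSo : opNorm ((1 - Ph) * S) ≤ 2 * x * q * q := by
    rw [hQhS]; exact opNorm_mul_le_of_le hQhPo hSo
  have hQhSf : ‖(1 - Ph) * S‖ ≤ 2 * x * q * (s * q) := by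
    rw [hQhS]; exact frobenius_mul_le_of_opNorm_le hQhPo hS
  -- `B` to first order
  have hBP : B * P = S - (1 - Ph) * S - B * X * S := by
    have : B * P = B * (A + X) * S - B * X * S := by
      rw [← Matrix.sub_mul, ← Matrix.mul_sub, add_sub_cancel_right, Matrix.mul_assoc, hAS]
    rw [this, hBA, Matrix.sub_mul, Matrix.one_mul, sub_sub_cancel]
  have hE : opNorm (B * P - S) ≤ 4 * x * q ^ 2 := by
    have : B * P - S = -((1 - Ph) * S) - B * X * S := by rw [hBP]; abel
    rw [this]
    refine (opNorm_sub_le _ _).trans ?_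
    rw [opNorm_neg]
    exact (add_le_add hQhSo (opNorm_mul_le_of_le (opNorm_mul_le_of_le hBo hX) hSo)).trans
      (by linarith)
  have hQB : (1 - P) * B = (1 - P) * X * B * B := by
    rw [← hQPh, Matrix.mul_assoc, hPhB]
  have hBQT : B * (1 - P) = ((1 - P) * B)ᵀ := by
    rw [transpose_mul, transpose_sub, hP, hBT, transpose_one]
  have hBQo : opNorm (B * (1 - P)) ≤ 4 * x * q ^ 2 := by
    rw [hBQT, opNorm_transpose, hQB]
    exact (opNorm_mul_le_of_le (opNorm_mul_le_of_le (opNorm_mul_le_of_le hQo hX) hBo) hBo).trans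
      (by linarith)
  have hBQf : ‖B * (1 - P)‖ ≤ 4 * s * x * q ^ 2 := by
    rw [hBQT, frobenius_norm_transpose, hQB]
    exact (frobenius_mul_le_of_opNorm_le
      (opNorm_mul_le_of_le (opNorm_mul_le_of_le hQo hX) hBo) hB).trans (by linarith)
  have hD : opNorm (B - S) ≤ 8 * x * q ^ 2 := by
    have : B - S = (B * P - S) + B * (1 - P) := by
      rw [Matrix.mul_sub, Matrix.mul_one]; abel
    rw [this]
    exact (opNorm_add_le _ _).trans (by linarith)
  -- `B P` to second order
  obtain ⟨R, hR, hRn⟩ : ∃ R, B * P = S + ((1 - P) * X * (S * S) - S * X * S) + R ∧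
      ‖R‖ ≤ 14 * s * x ^ 2 * q ^ 3 := by
    -- In `B P = S - (1 - Ph) S - B X S`, the middle term is rewritten through `(1 - Ph) P`. Then
    -- `Ph` is replaced by `P` and `B` by `S`. The three errors are bounded by 2, 4 and 8 times `s
    -- x² q³`, whence 14.
    refine ⟨-((1 - Ph) * (A + X) * ((1 - Ph) * S * S)) + (P - Ph) * X * (S * S)
      - (B - S) * X * S, ?_, ?_⟩
    · have e0 : (1 - Ph) * (A + X) * ((1 - Ph) * S * S) = (1 - Ph) * (A + X) * S * S := by
        rw [← Matrix.mul_assoc, ← Matrix.mul_assoc, ← hrest']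
      have e1 : (1 - Ph) * S = (1 - Ph) * (A + X) * ((1 - Ph) * S * S) - (1 - Ph) * X * (S * S) := by
        rw [e0, hQhS, hQhP, Matrix.sub_mul, Matrix.mul_assoc ((1 - Ph) * X)]
      rw [hBP]
      nth_rewrite 1 [e1]
      simp only [Matrix.sub_mul, Matrix.one_mul]
      abel
    · have f1 := frobenius_mul_le_of_opNorm_le hrest
        ((frobenius_mul_le_mul_opNorm ((1 - Ph) * S) S).trans
          (mul_le_mul hQhSf hSo (opNorm_nonneg _) ((norm_nonneg _).trans hQhSf)))
      have f2 := frobenius_mul_le_of_opNorm_le (opNorm_mul_le_of_le hdiff hX)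
        (frobenius_mul_le_of_opNorm_le hSo hS)
      have f3 := frobenius_mul_le_of_opNorm_le (opNorm_mul_le_of_le hD hX) hS
      refine (norm_sub_le _ _).trans ?_
      have := norm_add_le (-((1 - Ph) * (A + X) * ((1 - Ph) * S * S))) ((P - Ph) * X * (S * S))
      rw [norm_neg] at this
      linarith
  -- the squared distance
  rw [projection_sub_sq P Ph hP hPP hPh hPhPh htr, hQPh,
    frobenius_sq_eq_add_projection _ P hP hPP, cubicTerm_eq]
  have hL := frobenius_linear_le hQo hX hS
  have hC := frobenius_quadratic_le hQo hX hSo hS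
  have hsplit : (1 - P) * X * B * P = (1 - P) * X * S +
      ((1 - P) * X * ((1 - P) * X * (S * S) - S * X * S) + (1 - P) * X * R) := by
    rw [Matrix.mul_assoc, hR, Matrix.mul_add, Matrix.mul_add, add_assoc]
  have hR' : ‖(1 - P) * X * R‖ ≤ 14 * s * x ^ 3 * q ^ 3 :=
    (frobenius_mul_le_of_opNorm_le (opNorm_mul_le_of_le hQo hX) hRn).trans (by linarith)
  have hlast : ‖(1 - P) * X * B * (1 - P)‖ ≤ 4 * s * x ^ 2 * q ^ 2 := by
    rw [Matrix.mul_assoc]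
    exact (frobenius_mul_le_of_opNorm_le (opNorm_mul_le_of_le hQo hX) hBQf).trans (by linarith)
  rw [hsplit]
  generalize (1 - P) * X * ((1 - P) * X * (S * S) - S * X * S) = C at *
  generalize (1 - P) * X * S = K at *
  generalize (1 - P) * X * R = R' at *
  generalize (1 - P) * X * B * (1 - P) = W at *
  -- Since `x q ≤ 1/2`, the cubic `R'` is absorbed into the quadratic scale: 2 + 7 = 9.
  have hCR : ‖C + R'‖ ≤ 9 * s * x ^ 2 * q ^ 2 := by
    have : 14 * s * x ^ 3 * q ^ 3 ≤ 7 * s * x ^ 2 * q ^ 2 := by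
      have : 0 ≤ s * x ^ 2 * q ^ 2 := by positivity
      nlinarith
    exact (norm_add_le _ _).trans (by linarith)
  have hKR : |trace (Kᵀ * R')| ≤ 14 * s ^ 2 * x ^ 4 * q ^ 4 :=
    (abs_trace_transpose_mul_le _ _).trans
      ((mul_le_mul hL hR' (norm_nonneg _) (by positivity)).trans (by apply le_of_eq; ring))
  have hW2 : ‖W‖ ^ 2 ≤ 16 * s ^ 2 * x ^ 4 * q ^ 4 :=
    (pow_le_pow_left₀ (norm_nonneg _) hlast 2).trans (by apply le_of_eq; ring)
  have hCR2 : ‖C + R'‖ ^ 2 ≤ 81 * s ^ 2 * x ^ 4 * q ^ 4 :=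
    (pow_le_pow_left₀ (norm_nonneg _) hCR 2).trans (by apply le_of_eq; ring)
  have hKC : 2 * (‖K + (C + R')‖ ^ 2 + ‖W‖ ^ 2) - 2 * ‖K‖ ^ 2 - 4 * trace (Kᵀ * C) =
      4 * trace (Kᵀ * R') + 2 * ‖C + R'‖ ^ 2 + 2 * ‖W‖ ^ 2 := by
    rw [frobenius_add_sq, Matrix.mul_add, trace_add]; ring
  rw [hKC]
  -- The constant is 250 = 4 · 14 + 2 · 81 + 2 · 16.
  have hpos : 0 ≤ s ^ 2 * x ^ 4 * q ^ 4 := by positivity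
  rw [abs_le] at hKR ⊢
  constructor <;> nlinarith [sq_nonneg ‖C + R'‖, sq_nonneg ‖W‖]

end Perturbation

/-! ### Weyl's inequalities and truncated singular value decompositions. -/

section SingularValues

theorem frobenius_isometry_mul {m n l : Type*} [Fintype m] [Fintype n] [Fintype l] [DecidableEq n]
    {P : Matrix m n ℝ} (hP : Pᵀ * P = 1) (Y : Matrix n l ℝ) : ‖P * Y‖ = ‖Y‖ := by
  refine (sq_eq_sq₀ (norm_nonneg _) (norm_nonneg _)).1 ?_
  rw [frobenius_sq_eq_trace, frobenius_sq_eq_trace, transpose_mul, Matrix.mul_assoc,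
    ← Matrix.mul_assoc Pᵀ, hP, Matrix.one_mul]

theorem frobenius_diagonal_mul_sq {n l : Type*} [Fintype n] [Fintype l] [DecidableEq n]
    (d : n → ℝ) (Y : Matrix n l ℝ) : ‖diagonal d * Y‖ ^ 2 = ∑ i, ∑ j, d i ^ 2 * Y i j ^ 2 := by
  simp [frobenius_sq_eq_sum, diagonal_mul, mul_pow]

theorem mul_frobenius_le_diagonal_mul {n l : Type*} [Fintype n] [Fintype l] [DecidableEq n]
    {d : n → ℝ} {Y : Matrix n l ℝ} {c : ℝ} (hc : 0 ≤ c) (h : ∀ i j, Y i j ≠ 0 → c ≤ d i) :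
    c * ‖Y‖ ≤ ‖diagonal d * Y‖ := by
  refine (sq_le_sq₀ (by positivity) (norm_nonneg _)).1 ?_
  rw [mul_pow, frobenius_diagonal_mul_sq, frobenius_sq_eq_sum, Finset.mul_sum]
  refine Finset.sum_le_sum fun i _ => ?_
  rw [Finset.mul_sum]
  refine Finset.sum_le_sum fun j _ => ?_
  by_cases hY : Y i j = 0
  · simp [hY]
  · exact mul_le_mul_of_nonneg_right (pow_le_pow_left₀ hc (h i j hY) 2) (sq_nonneg _)

theorem diagonal_mul_le_mul_frobenius {n l : Type*} [Fintype n] [Fintype l] [DecidableEq n]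
    {d : n → ℝ} {Y : Matrix n l ℝ} {c : ℝ} (hc : 0 ≤ c) (h : ∀ i j, Y i j ≠ 0 → |d i| ≤ c) :
    ‖diagonal d * Y‖ ≤ c * ‖Y‖ := by
  refine (sq_le_sq₀ (norm_nonneg _) (by positivity)).1 ?_
  rw [mul_pow, frobenius_diagonal_mul_sq, frobenius_sq_eq_sum, Finset.mul_sum]
  refine Finset.sum_le_sum fun i _ => ?_
  rw [Finset.mul_sum]
  refine Finset.sum_le_sum fun j _ => ?_
  by_cases hY : Y i j = 0
  · simp [hY]
  · rw [← sq_abs (d i)]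
    exact mul_le_mul_of_nonneg_right (pow_le_pow_left₀ (abs_nonneg _) (h i j hY) 2) (sq_nonneg _)

/-- The test vector is a one-column matrix, so that the Frobenius estimates apply to it. -/
theorem exists_col_ne_zero_mul_eq_zero {α β : Type*} [Fintype α] [Fintype β] [DecidableEq β]
    (B : Matrix α β ℝ) (h : Fintype.card α < Fintype.card β) :
    ∃ c : Matrix β Unit ℝ, c ≠ 0 ∧ B * c = 0 := by
  have hk : LinearMap.ker (mulVecLin B) ≠ ⊥ := LinearMap.ker_ne_bot_of_finrank_lt (by simpa using h)
  obtain ⟨v, hv, hv0⟩ := Submodule.exists_mem_ne_zero_of_ne_bot hk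
  refine ⟨fun i _ => v i, fun h0 => hv0 (funext fun i => congrFun (congrFun h0 i) ()), ?_⟩
  ext i j
  exact congrFun (LinearMap.mem_ker.1 hv) i

variable {m n r k : ℕ}

/-- Weyl's inequality for the singular values of `A + Z` beyond the rank of `A`. -/
theorem IsSVD.le_opNorm_of_rank_le {A Z : Matrix (Fin m) (Fin n) ℝ} {U : Matrix (Fin m) (Fin r) ℝ}
    {V : Matrix (Fin n) (Fin r) ℝ} {lam : Fin r → ℝ} {P : Matrix (Fin m) (Fin k) ℝ}
    {σ : Fin k → ℝ} {Q : Matrix (Fin n) (Fin k) ℝ} (hA : IsSVD A U lam V)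
    (hB : IsSVD (A + Z) P σ Q) (i : Fin k) (hi : r ≤ i) : σ i ≤ opNorm Z := by
  -- The vector `c` is supported on coordinates up to `i`, and `Q c` is killed by `Vᵀ`, hence by
  -- `A`. This imposes `(k - 1 - i) + r < k` linear conditions.
  obtain ⟨c, hc0, hc⟩ := exists_col_ne_zero_mul_eq_zero
    (fromRows ((1 : Matrix (Fin k) (Fin k) ℝ).submatrix (Subtype.val : {j // i < j} → Fin k) id)
      (Vᵀ * Q)) (by
      have : Fintype.card {j // i < j} = k - 1 - i := by
        rw [Fintype.card_subtype, ← Fin.card_Ioi]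
        congr 1; ext j; simp
      rw [Fintype.card_sum, this]
      simp only [Fintype.card_fin]
      have := i.2
      omega)
  rw [fromRows_mul] at hc
  have hc1 : ∀ j, i < j → c j () = 0 := fun j hj => by
    have := congrFun (congrFun hc (Sum.inl ⟨j, hj⟩)) ()
    simpa [Matrix.mul_apply, Matrix.one_apply] using this
  have hc2 : Vᵀ * Q * c = 0 := by
    ext a b
    exact congrFun (congrFun hc (Sum.inr a)) b
  have hAc : A * (Q * c) = 0 := by
    rw [hA.eq_mul, Matrix.mul_assoc, ← Matrix.mul_assoc Vᵀ, hc2, Matrix.mul_zero]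
  have hBc : ‖diagonal σ * c‖ = ‖Z * (Q * c)‖ := by
    have : (A + Z) * (Q * c) = P * (diagonal σ * c) := by
      rw [hB.eq_mul, Matrix.mul_assoc, ← Matrix.mul_assoc Qᵀ, hB.right_orthonormal, Matrix.one_mul,
        Matrix.mul_assoc]
    rw [← frobenius_isometry_mul hB.left_orthonormal, ← this, Matrix.add_mul, hAc, zero_add]
  have h1 : σ i * ‖c‖ ≤ ‖diagonal σ * c‖ := by
    refine mul_frobenius_le_diagonal_mul (hB.nonneg i) fun a b hab => hB.antitone ?_
    by_contra! hia
    exact hab (hc1 a hia)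
  have h2 : ‖Z * (Q * c)‖ ≤ opNorm Z * ‖c‖ := by
    rw [← frobenius_isometry_mul hB.right_orthonormal c]
    exact frobenius_mul_le_opNorm_mul _ _
  rw [hBc] at h1
  exact le_of_mul_le_mul_right (h1.trans h2) (norm_pos_iff.2 hc0)

/-- Weyl's inequality for the smallest nonzero singular value of `A`. -/
theorem IsSVD.le_add_opNorm {A Z : Matrix (Fin m) (Fin n) ℝ} {U : Matrix (Fin m) (Fin r) ℝ}
    {V : Matrix (Fin n) (Fin r) ℝ} {lam : Fin r → ℝ} {P : Matrix (Fin m) (Fin k) ℝ}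
    {σ : Fin k → ℝ} {Q : Matrix (Fin n) (Fin k) ℝ} (hA : IsSVD A U lam V)
    (hB : IsSVD (A + Z) P σ Q) (i : Fin k) (hi : (i : ℕ) < r) {l : ℝ} (hl0 : 0 ≤ l)
    (hl : ∀ j, l ≤ lam j) : l ≤ σ i + opNorm Z := by
  -- `V c` is taken orthogonal to the first `i` right singular vectors of `A + Z`, which is `i < r`
  -- conditions on `c`.
  obtain ⟨c, hc0, hc⟩ := exists_col_ne_zero_mul_eq_zero
    ((Qᵀ * V).submatrix (Subtype.val : {j // j < i} → Fin k) id) (by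
      have : Fintype.card {j // j < i} = i := by
        rw [Fintype.card_subtype, ← Fin.card_Iio]
        congr 1; ext j; simp
      rw [this, Fintype.card_fin]; exact hi)
  have hc1 : ∀ j, j < i → (Qᵀ * V * c) j () = 0 := fun j hj =>
    congrFun (congrFun hc ⟨j, hj⟩) ()
  have hVc : ‖V * c‖ = ‖c‖ := frobenius_isometry_mul hA.right_orthonormal c
  have h1 : l * ‖c‖ ≤ ‖A * (V * c)‖ := by
    have : A * (V * c) = U * (diagonal lam * c) := by
      rw [hA.eq_mul, Matrix.mul_assoc, ← Matrix.mul_assoc Vᵀ, hA.right_orthonormal, Matrix.one_mul,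
        Matrix.mul_assoc]
    rw [this, frobenius_isometry_mul hA.left_orthonormal]
    exact mul_frobenius_le_diagonal_mul hl0 fun a _ _ => hl a
  have h2 : ‖(A + Z) * (V * c)‖ ≤ σ i * ‖c‖ := by
    have : (A + Z) * (V * c) = P * (diagonal σ * (Qᵀ * V * c)) := by
      rw [hB.eq_mul, Matrix.mul_assoc, Matrix.mul_assoc, Matrix.mul_assoc]
    rw [this, frobenius_isometry_mul hB.left_orthonormal]
    refine (diagonal_mul_le_mul_frobenius (hB.nonneg i) fun a b hab => ?_).trans
      (mul_le_mul_of_nonneg_left ?_ (hB.nonneg i))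
    · rw [abs_of_nonneg (hB.nonneg a)]
      refine hB.antitone ?_
      by_contra! hia
      exact hab (hc1 a hia)
    · rw [Matrix.mul_assoc, ← hVc]
      refine (frobenius_mul_le_of_opNorm_le (a := 1) ?_ le_rfl).trans (by rw [one_mul])
      rw [opNorm_transpose]
      exact opNorm_le_one_of_transpose_mul_self _ hB.right_orthonormal
  have h3 : ‖Z * (V * c)‖ ≤ opNorm Z * ‖c‖ := by
    rw [← hVc]; exact frobenius_mul_le_opNorm_mul _ _
  have h4 : ‖A * (V * c)‖ ≤ ‖(A + Z) * (V * c)‖ + ‖Z * (V * c)‖ := by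
    have : A * (V * c) = (A + Z) * (V * c) - Z * (V * c) := by
      rw [Matrix.add_mul, add_sub_cancel_right]
    rw [this]; exact norm_sub_le _ _
  refine le_of_mul_le_mul_right ?_ (norm_pos_iff.2 hc0)
  linarith

theorem submatrix_castLE_mul_transpose (h : r ≤ k) (P : Matrix (Fin m) (Fin k) ℝ)
    (Q : Matrix (Fin n) (Fin k) ℝ) (d : Fin k → ℝ) :
    P.submatrix id (Fin.castLE h) * diagonal (d ∘ Fin.castLE h) *
      (Q.submatrix id (Fin.castLE h))ᵀ =
      P * diagonal (fun i : Fin k => if (i : ℕ) < r then d i else 0) * Qᵀ := by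
  ext a b
  rw [Matrix.mul_apply, Matrix.mul_apply]
  simp_rw [mul_diagonal]
  simp only [submatrix_apply, transpose_apply, id, Function.comp_apply, mul_ite, ite_mul, mul_zero,
    zero_mul]
  rw [← Finset.sum_filter]
  refine Finset.sum_bij (fun i _ => Fin.castLE h i) (by simp) (fun _ _ _ _ hij => by
    simpa using hij) (fun i hi => ?_) (by simp)
  exact ⟨⟨i, (Finset.mem_filter.1 hi).2⟩, Finset.mem_univ _, by simp⟩

theorem submatrix_castLE_orthonormal (h : r ≤ k) {P : Matrix (Fin m) (Fin k) ℝ}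
    (hP : Pᵀ * P = 1) :
    (P.submatrix id (Fin.castLE h))ᵀ * P.submatrix id (Fin.castLE h) = 1 := by
  have := congrArg (fun X => X.submatrix (Fin.castLE h) (Fin.castLE h)) hP
  simp only [submatrix_one _ (Fin.castLE_injective h)] at this
  rw [← this]; rfl

end SingularValues

/-! ### The expansion in eigenvector coordinates. -/

section Eigen

variable {ι κ : Type*} [Fintype ι] [DecidableEq ι] [Fintype κ] [DecidableEq κ]

theorem opNorm_conj_diagonal_le {Θ : Matrix ι κ ℝ} (hΘ : Θᵀ * Θ = 1) {E : κ → ℝ} {q : ℝ}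
    (hq : 0 ≤ q) (hE : ∀ k, |E k| ≤ q) : opNorm (Θ * diagonal E * Θᵀ) ≤ q := by
  have h := opNorm_le_one_of_transpose_mul_self Θ hΘ
  have h' : opNorm Θᵀ ≤ 1 := by rwa [opNorm_transpose]
  exact (opNorm_mul_le_of_le (opNorm_mul_le_of_le h (opNorm_diagonal_le E hq hE)) h').trans
    (by linarith)

theorem frobenius_conj_diagonal_le {Θ : Matrix ι κ ℝ} (hΘ : Θᵀ * Θ = 1) {E : κ → ℝ} {q : ℝ}
    (hq : 0 ≤ q) (hE : ∀ k, |E k| ≤ q) :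
    ‖Θ * diagonal E * Θᵀ‖ ≤ √(Fintype.card κ) * q := by
  rw [← frobenius_norm_transpose, transpose_mul, transpose_transpose,
    frobenius_isometry_mul hΘ, frobenius_norm_transpose, frobenius_isometry_mul hΘ]
  exact frobenius_diagonal_le E hq hE

theorem frobenius_projection_sq {Θ : Matrix ι κ ℝ} (hΘ : Θᵀ * Θ = 1) :
    ‖Θ * Θᵀ‖ ^ 2 = Fintype.card κ := by
  rw [frobenius_isometry_mul hΘ, frobenius_norm_transpose, frobenius_sq_eq_trace, hΘ, trace_one]

/-- `projection_expansion` in terms of eigenvectors. -/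
theorem projection_expansion_of_eigenvectors {A X : Matrix ι ι ℝ} {Θ Θh : Matrix ι κ ℝ}
    {D E Dh Eh : κ → ℝ} {x q : ℝ} (hx : 0 ≤ x) (hq : 0 ≤ q) (hxq : x * q ≤ 1 / 2)
    (hΘ : Θᵀ * Θ = 1) (hΘh : Θhᵀ * Θh = 1) (hA : A = Θ * diagonal D * Θᵀ)
    (hDE : ∀ k, D k * E k = 1) (hE : ∀ k, |E k| ≤ q) (hsymm : (A + X)ᵀ = A + X)
    (hAh : (A + X) * Θh = Θh * diagonal Dh) (hDEh : ∀ k, Dh k * Eh k = 1)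
    (hEh : ∀ k, |Eh k| ≤ 2 * q) (hX : opNorm X ≤ x)
    (hrest : opNorm ((1 - Θh * Θhᵀ) * (A + X)) ≤ x) :
    |‖Θh * Θhᵀ - Θ * Θᵀ‖ ^ 2 - 2 * ‖(1 - Θ * Θᵀ) * X * (Θ * diagonal E * Θᵀ)‖ ^ 2
      - cubicTerm (Θ * Θᵀ) (Θ * diagonal E * Θᵀ) X| ≤
      250 * Fintype.card κ * x ^ 4 * q ^ 4 := by
  have hD : diagonal D * diagonal E = 1 := by
    rw [diagonal_mul_diagonal, ← diagonal_one]; congr 1; ext k; exact hDE k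
  have hDh : diagonal Dh * diagonal Eh = 1 := by
    rw [diagonal_mul_diagonal, ← diagonal_one]; congr 1; ext k; exact hDEh k
  have cancel {Ψ : Matrix ι κ ℝ} (hΨ : Ψᵀ * Ψ = 1) (Y : Matrix κ ι ℝ) : Ψᵀ * (Ψ * Y) = Y := by
    rw [← Matrix.mul_assoc, hΨ, Matrix.one_mul]
  have hAB : (A + X) * (Θh * diagonal Eh * Θhᵀ) = Θh * Θhᵀ := by
    rw [← Matrix.mul_assoc, ← Matrix.mul_assoc, hAh, Matrix.mul_assoc Θh, hDh, Matrix.mul_one]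
  have hBT : (Θh * diagonal Eh * Θhᵀ)ᵀ = Θh * diagonal Eh * Θhᵀ := by
    simp [Matrix.mul_assoc]
  have hPh : (Θh * Θhᵀ)ᵀ = Θh * Θhᵀ := by simp
  have hAP : (A + X) * (Θh * Θhᵀ) = Θh * diagonal Dh * Θhᵀ := by rw [← Matrix.mul_assoc, hAh]
  have h := projection_expansion (A := A) (X := X) (P := Θ * Θᵀ) (Ph := Θh * Θhᵀ)
    (S := Θ * diagonal E * Θᵀ) (B := Θh * diagonal Eh * Θhᵀ) (s := √(Fintype.card κ))
    hx hq (by positivity) hxq (by simp) (by simp only [Matrix.mul_assoc, cancel hΘ])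
    hPh (by simp only [Matrix.mul_assoc, cancel hΘh])
    (by rw [trace_mul_comm, hΘ, trace_mul_comm, hΘh])
    (by simp only [hA, Matrix.mul_assoc, cancel hΘ])
    (by
      simp only [hA, Matrix.mul_assoc, cancel hΘ]
      rw [← Matrix.mul_assoc (diagonal D), hD, Matrix.one_mul])
    (by simp only [Matrix.mul_assoc, cancel hΘ])
    (by
      rw [← transpose_inj, transpose_mul, hBT, hsymm, hPh, hAB])
    hAB (by simp only [Matrix.mul_assoc, cancel hΘh]) hBT
    (by
      rw [hAP, ← transpose_inj, transpose_mul, hPh, hsymm, hAP]; simp [Matrix.mul_assoc])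
    hX (opNorm_conj_diagonal_le hΘ hq hE) (frobenius_conj_diagonal_le hΘ hq hE)
    (opNorm_conj_diagonal_le hΘh (by positivity) hEh)
    ((frobenius_conj_diagonal_le hΘh (by positivity) hEh).trans (by linarith)) hrest
  rwa [Real.sq_sqrt (by positivity)] at h

end Eigen

/-! ### Symmetric dilation: from singular vectors to eigenvectors. -/

section Dilation

variable {m n r : ℕ}

theorem fromBlocks_diagonal_sub {m n : Type*} (A A' : Matrix m m ℝ) (B B' : Matrix n n ℝ) :
    fromBlocks A 0 0 B - fromBlocks A' 0 0 B' = fromBlocks (A - A') 0 0 (B - B') := by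
  simp [sub_eq_add_neg, fromBlocks_neg, fromBlocks_add]

theorem thetaMat_orthonormal {U : Matrix (Fin m) (Fin r) ℝ} {V : Matrix (Fin n) (Fin r) ℝ}
    (hU : Uᵀ * U = 1) (hV : Vᵀ * V = 1) : (thetaMat U V)ᵀ * thetaMat U V = 1 := by
  have h2 : (√2)⁻¹ * (√2)⁻¹ = (2 : ℝ)⁻¹ := by rw [← mul_inv, Real.mul_self_sqrt (by norm_num)]
  have h3 : (2 : ℝ)⁻¹ • (1 : Matrix (Fin r) (Fin r) ℝ) + (2 : ℝ)⁻¹ • 1 = 1 := by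
    rw [← add_smul]; norm_num
  simp [thetaMat, fromBlocks_transpose, fromBlocks_multiply, fromBlocks_smul, smul_smul, h2, hU, hV,
    h3]

/-- With opposite eigenvalues on the two halves, the diagonal blocks cancel. Taking `f = lam` gives
the dilation of `M`; taking the inverses gives `projInv`. -/
theorem thetaMat_conj_diagonal (U : Matrix (Fin m) (Fin r) ℝ) (V : Matrix (Fin n) (Fin r) ℝ)
    (f : Fin r → ℝ) :
    thetaMat U V * diagonal (Sum.elim f (fun i => -f i)) * (thetaMat U V)ᵀ =
      symmDilation (U * diagonal f * Vᵀ) := by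
  have h2 : (√2)⁻¹ * (√2)⁻¹ = (2 : ℝ)⁻¹ := by rw [← mul_inv, Real.mul_self_sqrt (by norm_num)]
  have h3 {a b : ℕ} (Y : Matrix (Fin a) (Fin b) ℝ) : (2 : ℝ)⁻¹ • Y + (2 : ℝ)⁻¹ • Y = Y := by
    rw [← add_smul]; norm_num
  have h4 : diagonal (fun i => -f i) = -diagonal f := (diagonal_neg f).symm
  rw [← fromBlocks_diagonal, h4]
  simp [-fromBlocks_diagonal, -diagonal_neg, thetaMat, symmDilation, fromBlocks_transpose, fromBlocks_multiply, fromBlocks_smul,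
    smul_smul, h2, h3, Matrix.mul_assoc]

theorem thetaMat_mul_transpose (U : Matrix (Fin m) (Fin r) ℝ) (V : Matrix (Fin n) (Fin r) ℝ) :
    thetaMat U V * (thetaMat U V)ᵀ = fromBlocks (U * Uᵀ) 0 0 (V * Vᵀ) := by
  have h2 : (√2)⁻¹ * (√2)⁻¹ = (2 : ℝ)⁻¹ := by rw [← mul_inv, Real.mul_self_sqrt (by norm_num)]
  have h3 {a b : ℕ} (Y : Matrix (Fin a) (Fin b) ℝ) : (2 : ℝ)⁻¹ • Y + (2 : ℝ)⁻¹ • Y = Y := by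
    rw [← add_smul]; norm_num
  simp [thetaMat, fromBlocks_transpose, fromBlocks_multiply, fromBlocks_smul,
    smul_smul, h2, h3]

theorem symmDilation_mul_thetaMat {A : Matrix (Fin m) (Fin n) ℝ} {U : Matrix (Fin m) (Fin r) ℝ}
    {V : Matrix (Fin n) (Fin r) ℝ} {f : Fin r → ℝ} (h1 : A * V = U * diagonal f)
    (h2 : Aᵀ * U = V * diagonal f) :
    symmDilation A * thetaMat U V =
      thetaMat U V * diagonal (Sum.elim f (fun i => -f i)) := by
  have h4 : diagonal (fun i => -f i) = -diagonal f := (diagonal_neg f).symm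
  rw [← fromBlocks_diagonal, h4]
  simp [-fromBlocks_diagonal, -diagonal_neg, thetaMat, symmDilation, fromBlocks_multiply, h1, h2]

theorem frobenius_fromBlocks_diagonal_sq {a b : ℕ} (A : Matrix (Fin a) (Fin a) ℝ)
    (B : Matrix (Fin b) (Fin b) ℝ) : ‖fromBlocks A 0 0 B‖ ^ 2 = ‖A‖ ^ 2 + ‖B‖ ^ 2 := by
  simp [frobenius_sq_eq_sum, Fintype.sum_sum_type]

theorem distSq_eq_thetaMat (Uh : Matrix (Fin m) (Fin r) ℝ) (Vh : Matrix (Fin n) (Fin r) ℝ)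
    (U : Matrix (Fin m) (Fin r) ℝ) (V : Matrix (Fin n) (Fin r) ℝ) :
    distSq Uh Vh U V =
      ‖thetaMat Uh Vh * (thetaMat Uh Vh)ᵀ - thetaMat U V * (thetaMat U V)ᵀ‖ ^ 2 := by
  rw [thetaMat_mul_transpose, thetaMat_mul_transpose, fromBlocks_diagonal_sub,
    frobenius_fromBlocks_diagonal_sq, distSq]

theorem opNorm_symmDilation_le (Z : Matrix (Fin m) (Fin n) ℝ) :
    opNorm (symmDilation Z) ≤ opNorm Z := by
  refine opNorm_le_of_dotProduct_le _ (opNorm_nonneg _) fun x => ?_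
  obtain ⟨y, z, rfl⟩ : ∃ (y : Fin m → ℝ) (z : Fin n → ℝ), x = Sum.elim y z :=
    ⟨x ∘ Sum.inl, x ∘ Sum.inr, (Sum.elim_comp_inl_inr x).symm⟩
  have h1 := mulVec_dotProduct_self_le Z z
  have h2 := mulVec_dotProduct_self_le Zᵀ y
  rw [opNorm_transpose] at h2
  simp only [symmDilation, fromBlocks_mulVec, zero_mulVec, zero_add, add_zero,
    Sum.elim_comp_inl, Sum.elim_comp_inr, sumElim_dotProduct_sumElim]
  linarith

theorem symmDilation_add (A B : Matrix (Fin m) (Fin n) ℝ) :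
    symmDilation (A + B) = symmDilation A + symmDilation B := by
  simp [symmDilation, fromBlocks_add]

theorem symmDilation_neg (A : Matrix (Fin m) (Fin n) ℝ) :
    symmDilation (-A) = -symmDilation A := by
  simp [symmDilation, fromBlocks_neg]

theorem symmDilation_transpose (A : Matrix (Fin m) (Fin n) ℝ) :
    (symmDilation A)ᵀ = symmDilation A := by
  simp [symmDilation, fromBlocks_transpose]

theorem projInv_eq (U : Matrix (Fin m) (Fin r) ℝ) (V : Matrix (Fin n) (Fin r) ℝ)
    (lam : Fin r → ℝ) : projInv U V lam =
      thetaMat U V * diagonal (Sum.elim (fun i => (lam i)⁻¹) (fun i => -(lam i)⁻¹)) *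
        (thetaMat U V)ᵀ := by
  simp [projInv, inv_neg]

theorem projInv_eq_symmDilation (U : Matrix (Fin m) (Fin r) ℝ) (V : Matrix (Fin n) (Fin r) ℝ)
    (lam : Fin r → ℝ) : projInv U V lam = symmDilation (U * diagonal (fun i => (lam i)⁻¹) * Vᵀ) := by
  rw [projInv_eq, thetaMat_conj_diagonal]

theorem opNorm_mul_diagonal_mul_transpose_le {k : ℕ} {P : Matrix (Fin m) (Fin k) ℝ}
    {Q : Matrix (Fin n) (Fin k) ℝ} {σ : Fin k → ℝ} {c : ℝ} (hP : Pᵀ * P = 1) (hQ : Qᵀ * Q = 1)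
    (hc : 0 ≤ c) (hσ : ∀ i, |σ i| ≤ c) : opNorm (P * diagonal σ * Qᵀ) ≤ c := by
  have h' : opNorm Qᵀ ≤ 1 := by
    rw [opNorm_transpose]; exact opNorm_le_one_of_transpose_mul_self Q hQ
  exact (opNorm_mul_le_of_le (opNorm_mul_le_of_le (opNorm_le_one_of_transpose_mul_self P hP)
    (opNorm_diagonal_le σ hc hσ)) h').trans (by linarith)

/-- The commutation hypothesis makes the product the dilation of `A - U Uᵀ A`. -/
theorem opNorm_one_sub_mul_symmDilation_le {A : Matrix (Fin m) (Fin n) ℝ}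
    {U : Matrix (Fin m) (Fin r) ℝ} {V : Matrix (Fin n) (Fin r) ℝ}
    (h : U * Uᵀ * A = A * (V * Vᵀ)) :
    opNorm ((1 - thetaMat U V * (thetaMat U V)ᵀ) * symmDilation A) ≤ opNorm (A - U * Uᵀ * A) := by
  refine le_trans (le_of_eq ?_) (opNorm_symmDilation_le _)
  congr 1
  have h' : V * Vᵀ * Aᵀ = (U * Uᵀ * A)ᵀ := by rw [h]; simp [Matrix.mul_assoc]
  rw [thetaMat_mul_transpose, ← fromBlocks_one, fromBlocks_diagonal_sub, symmDilation, symmDilation,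
    fromBlocks_multiply]
  simp [Matrix.sub_mul, h', Matrix.mul_assoc]

end Dilation

/-! ### The expansion of the squared distance for a fixed noise matrix. -/

section Deterministic

variable {m n r : ℕ}

/-- Both projections of the dilation have squared norm `2r`, and `(a + b)² ≤ 2a² + 2b²`. -/
theorem distSq_le {Uh U : Matrix (Fin m) (Fin r) ℝ} {Vh V : Matrix (Fin n) (Fin r) ℝ}
    (hUh : Uhᵀ * Uh = 1) (hVh : Vhᵀ * Vh = 1) (hU : Uᵀ * U = 1) (hV : Vᵀ * V = 1) :
    distSq Uh Vh U V ≤ 8 * r := by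
  rw [distSq_eq_thetaMat]
  have h1 := frobenius_projection_sq (thetaMat_orthonormal hU hV)
  have h2 := frobenius_projection_sq (thetaMat_orthonormal hUh hVh)
  rw [Fintype.card_sum, Fintype.card_fin] at h1 h2
  push_cast at h1 h2
  have h3 := norm_sub_le (thetaMat Uh Vh * (thetaMat Uh Vh)ᵀ) (thetaMat U V * (thetaMat U V)ᵀ)
  have h4 := pow_le_pow_left₀ (norm_nonneg _) h3 2
  nlinarith [sq_nonneg (‖thetaMat Uh Vh * (thetaMat Uh Vh)ᵀ‖ - ‖thetaMat U V * (thetaMat U V)ᵀ‖)]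

theorem IsTopSingularVectors.orthonormal {A : Matrix (Fin m) (Fin n) ℝ}
    {Uh : Matrix (Fin m) (Fin r) ℝ} {Vh : Matrix (Fin n) (Fin r) ℝ}
    (h : IsTopSingularVectors A Uh Vh) : Uhᵀ * Uh = 1 ∧ Vhᵀ * Vh = 1 := by
  obtain ⟨hr, P, σ, Q, hsvd, rfl, rfl⟩ := h
  exact ⟨submatrix_castLE_orthonormal hr hsvd.left_orthonormal,
    submatrix_castLE_orthonormal hr hsvd.right_orthonormal⟩

theorem abs_sumElim_neg_le {κ : Type*} {f : κ → ℝ} {c : ℝ} (h : ∀ i, |f i| ≤ c) (k : κ ⊕ κ) :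
    |Sum.elim f (fun i => -f i) k| ≤ c := by
  rcases k with k | k <;> simp [h k]

theorem sumElim_neg_mul_eq_one {κ : Type*} {f g : κ → ℝ} (h : ∀ i, f i * g i = 1) (k : κ ⊕ κ) :
    Sum.elim f (fun i => -f i) k * Sum.elim g (fun i => -g i) k = 1 := by
  rcases k with k | k <;> simp [h k]

/-- The expansion when the noise is at most half of the smallest singular value. -/
theorem distSq_expansion_of_opNorm_le {M Z : Matrix (Fin m) (Fin n) ℝ}
    {U Uh : Matrix (Fin m) (Fin r) ℝ} {V Vh : Matrix (Fin n) (Fin r) ℝ} {lam : Fin r → ℝ} {l : ℝ}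
    (hM : IsSVD M U lam V) (hl0 : 0 < l) (hl : ∀ i, l ≤ lam i)
    (h : IsTopSingularVectors (M + Z) Uh Vh) (hZ : opNorm Z ≤ l / 2) :
    |distSq Uh Vh U V - 2 * ‖projPerp U V * symmDilation Z * projInv U V lam‖ ^ 2
      - cubicTerm (thetaMat U V * (thetaMat U V)ᵀ) (projInv U V lam) (symmDilation Z)| ≤
      500 * r * (opNorm Z / l) ^ 4 := by
  obtain ⟨hr, P, σ, Q, hsvd, rfl, rfl⟩ := h
  have hUh := submatrix_castLE_orthonormal hr hsvd.left_orthonormal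
  have hVh := submatrix_castLE_orthonormal hr hsvd.right_orthonormal
  have hσ (i : Fin r) : l / 2 ≤ σ (Fin.castLE hr i) := by
    have := hM.le_add_opNorm hsvd (Fin.castLE hr i) (by simp) hl0.le hl
    linarith
  have hproj {a : ℕ} (P : Matrix (Fin a) (Fin (min m n)) ℝ) :=
    submatrix_castLE_mul_transpose hr P P (fun _ => 1)
  have hcol {a b : ℕ} (P : Matrix (Fin a) (Fin (min m n)) ℝ)
      (Q : Matrix (Fin b) (Fin (min m n)) ℝ) (hQ : Qᵀ * Q = 1) :
      P * diagonal σ * Qᵀ * Q.submatrix id (Fin.castLE hr) =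
        P.submatrix id (Fin.castLE hr) * diagonal (σ ∘ Fin.castLE hr) := by
    have e : Qᵀ * Q.submatrix id (Fin.castLE hr) = (1 : Matrix _ _ ℝ).submatrix id (Fin.castLE hr) := by
      rw [← hQ]; rfl
    rw [Matrix.mul_assoc, e]
    ext i j
    rw [mul_diagonal, Matrix.mul_apply]
    simp_rw [mul_diagonal]
    simp [Matrix.one_apply]
  have hMT : (M + Z)ᵀ = Q * diagonal σ * Pᵀ := by
    rw [hsvd.eq_mul]; simp [Matrix.mul_assoc]
  have hone : diagonal ((fun _ : Fin (min m n) => (1 : ℝ)) ∘ Fin.castLE hr) = 1 := by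
    rw [← diagonal_one]; rfl
  simp only [hone, Matrix.mul_one] at hproj
  have hUM : P.submatrix id (Fin.castLE hr) * (P.submatrix id (Fin.castLE hr))ᵀ * (M + Z) =
      P * diagonal (fun i : Fin (min m n) => if (i : ℕ) < r then σ i else 0) * Qᵀ := by
    rw [hproj, hsvd.eq_mul, Matrix.mul_assoc _ Pᵀ, ← Matrix.mul_assoc Pᵀ, ← Matrix.mul_assoc Pᵀ,
      hsvd.left_orthonormal, Matrix.one_mul, ← Matrix.mul_assoc, Matrix.mul_assoc P,
      diagonal_mul_diagonal]
    simp
  have hMV : (M + Z) * (Q.submatrix id (Fin.castLE hr) * (Q.submatrix id (Fin.castLE hr))ᵀ) =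
      P * diagonal (fun i : Fin (min m n) => if (i : ℕ) < r then σ i else 0) * Qᵀ := by
    rw [hproj, hsvd.eq_mul, Matrix.mul_assoc _ Qᵀ, ← Matrix.mul_assoc Qᵀ, ← Matrix.mul_assoc Qᵀ,
      hsvd.right_orthonormal, Matrix.one_mul, ← Matrix.mul_assoc, Matrix.mul_assoc P,
      diagonal_mul_diagonal]
    simp
  have hσ0 (i : Fin r) : σ (Fin.castLE hr i) ≠ 0 := by
    have := hσ i; intro h0; linarith
  have hlam0 (i : Fin r) : lam i ≠ 0 := by
    have := hl i; intro h0; linarith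
  have key := projection_expansion_of_eigenvectors (A := symmDilation M) (X := symmDilation Z)
    (Θ := thetaMat U V)
    (Θh := thetaMat (P.submatrix id (Fin.castLE hr)) (Q.submatrix id (Fin.castLE hr)))
    (D := Sum.elim lam (fun i => -lam i))
    (E := Sum.elim (fun i => (lam i)⁻¹) (fun i => -(lam i)⁻¹))
    (Dh := Sum.elim (σ ∘ Fin.castLE hr) (fun i => -(σ ∘ Fin.castLE hr) i))
    (Eh := Sum.elim (fun i => ((σ ∘ Fin.castLE hr) i)⁻¹) (fun i => -((σ ∘ Fin.castLE hr) i)⁻¹))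
    (x := opNorm Z) (q := l⁻¹) (opNorm_nonneg Z) (by positivity)
    (by rw [← div_eq_mul_inv, div_le_iff₀ hl0]; linarith)
    (thetaMat_orthonormal hM.left_orthonormal hM.right_orthonormal)
    (thetaMat_orthonormal hUh hVh)
    (by rw [thetaMat_conj_diagonal, ← hM.eq_mul])
    (sumElim_neg_mul_eq_one fun i => mul_inv_cancel₀ (hlam0 i))
    (abs_sumElim_neg_le fun i => by
      rw [abs_of_nonneg (inv_nonneg.2 (hM.nonneg i))]
      exact inv_anti₀ hl0 (hl i))
    (by rw [← symmDilation_add, symmDilation_transpose])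
    (by
      rw [← symmDilation_add]
      refine symmDilation_mul_thetaMat ?_ ?_
      · rw [hsvd.eq_mul]; exact hcol P Q hsvd.right_orthonormal
      · rw [hMT]; exact hcol Q P hsvd.left_orthonormal)
    (sumElim_neg_mul_eq_one fun i => mul_inv_cancel₀ (hσ0 i))
    (abs_sumElim_neg_le fun i => by
      rw [Function.comp_apply, abs_of_nonneg (inv_nonneg.2 (hsvd.nonneg _))]
      refine (inv_anti₀ (half_pos hl0) (hσ i)).trans (le_of_eq ?_)
      field_simp)
    (opNorm_symmDilation_le Z)
    (by
      rw [← symmDilation_add]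
      refine (opNorm_one_sub_mul_symmDilation_le (hUM.trans hMV.symm)).trans ?_
      -- Removing the top `r` terms leaves the singular values of index at least `r`. These are at
      -- most `‖Z‖` by Weyl, as `M` has rank `r`.
      rw [hUM]
      nth_rewrite 1 [hsvd.eq_mul]
      rw [← Matrix.sub_mul, ← Matrix.mul_sub, diagonal_sub]
      refine opNorm_mul_diagonal_mul_transpose_le hsvd.left_orthonormal hsvd.right_orthonormal
        (opNorm_nonneg _) fun i => ?_
      split_ifs with hi
      · simp [opNorm_nonneg]
      · rw [sub_zero, abs_of_nonneg (hsvd.nonneg i)]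
        exact hM.le_opNorm_of_rank_le hsvd i (not_lt.1 hi))
  rw [← projInv_eq, ← distSq_eq_thetaMat] at key
  refine key.trans (le_of_eq ?_)
  rw [Fintype.card_sum, Fintype.card_fin]
  push_cast
  rw [div_pow, inv_pow]
  ring

theorem frobenius_projPerp_mul_projInv_le {U : Matrix (Fin m) (Fin r) ℝ}
    {V : Matrix (Fin n) (Fin r) ℝ} {lam : Fin r → ℝ} {l : ℝ} (hU : Uᵀ * U = 1) (hV : Vᵀ * V = 1)
    (hl0 : 0 < l) (hl : ∀ i, l ≤ lam i) (Z : Matrix (Fin m) (Fin n) ℝ) :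
    ‖projPerp U V * symmDilation Z * projInv U V lam‖ ^ 2 ≤ 2 * r * (opNorm Z / l) ^ 2 ∧
    |cubicTerm (thetaMat U V * (thetaMat U V)ᵀ) (projInv U V lam) (symmDilation Z)| ≤
      16 * r * (opNorm Z / l) ^ 3 := by
  have hΘ := thetaMat_orthonormal hU hV
  have hQ : opNorm (1 - thetaMat U V * (thetaMat U V)ᵀ) ≤ 1 := by
    refine opNorm_one_sub_projection_le _ (by simp) ?_
    rw [Matrix.mul_assoc, ← Matrix.mul_assoc _ᵀ, hΘ, Matrix.one_mul]
  have hE : ∀ k, |Sum.elim (fun i => (lam i)⁻¹) (fun i => -(lam i)⁻¹) k| ≤ l⁻¹ :=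
    abs_sumElim_neg_le fun i => by
      rw [abs_of_nonneg (inv_nonneg.2 (hl0.le.trans (hl i)))]
      exact inv_anti₀ hl0 (hl i)
  have hSo := opNorm_conj_diagonal_le hΘ (by positivity) hE
  have hS := frobenius_conj_diagonal_le hΘ (by positivity) hE
  rw [← projInv_eq] at hSo hS
  have hs : √(Fintype.card (Fin r ⊕ Fin r)) ^ 2 = 2 * r := by
    rw [Real.sq_sqrt (by positivity), Fintype.card_sum, Fintype.card_fin]
    push_cast; ring
  constructor
  · refine (pow_le_pow_left₀ (norm_nonneg _)
      (frobenius_linear_le hQ (opNorm_symmDilation_le Z) hS) 2).trans (le_of_eq ?_)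
    rw [mul_pow, mul_pow, hs, div_pow, inv_pow]
    ring
  · refine (abs_cubicTerm_le hQ (opNorm_symmDilation_le Z) hSo hS).trans (le_of_eq ?_)
    rw [hs, div_pow, inv_pow]
    ring

/-- Fourth order expansion of the squared distance, for every noise matrix. -/
theorem distSq_expansion {M Z : Matrix (Fin m) (Fin n) ℝ}
    {U Uh : Matrix (Fin m) (Fin r) ℝ} {V Vh : Matrix (Fin n) (Fin r) ℝ} {lam : Fin r → ℝ} {l : ℝ}
    (hM : IsSVD M U lam V) (hl0 : 0 < l) (hl : ∀ i, l ≤ lam i)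
    (h : IsTopSingularVectors (M + Z) Uh Vh) :
    |distSq Uh Vh U V - 2 * ‖projPerp U V * symmDilation Z * projInv U V lam‖ ^ 2
      - cubicTerm (thetaMat U V * (thetaMat U V)ᵀ) (projInv U V lam) (symmDilation Z)| ≤
      500 * r * (opNorm Z / l) ^ 4 := by
  rcases le_or_gt (opNorm Z) (l / 2) with hZ | hZ
  · exact distSq_expansion_of_opNorm_le hM hl0 hl h hZ
  -- Here `t = ‖Z‖ / l > 1/2`, so lower powers of `t` are dominated by `t⁴`: `8r + 4r t² + 16r t³ ≤
  -- (128 + 16 + 32) r t⁴`.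
  · obtain ⟨h1, h2⟩ :=
      frobenius_projPerp_mul_projInv_le hM.left_orthonormal hM.right_orthonormal hl0 hl Z
    have h3 := distSq_le h.orthonormal.1 h.orthonormal.2 hM.left_orthonormal hM.right_orthonormal
    have h3' : 0 ≤ distSq Uh Vh U V := by unfold distSq; positivity
    have h1' : 0 ≤ ‖projPerp U V * symmDilation Z * projInv U V lam‖ ^ 2 := by positivity
    have ht : 1 / 2 ≤ opNorm Z / l := by rw [le_div_iff₀ hl0]; linarith
    generalize opNorm Z / l = t at *
    have hr : (0 : ℝ) ≤ r := by positivity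
    have t2 : 1 / 4 ≤ t ^ 2 := by nlinarith
    have t3 : t ^ 3 ≤ 2 * t ^ 4 := by nlinarith [mul_nonneg (sq_nonneg t) (by linarith : 0 ≤ t)]
    have t4 : t ^ 2 ≤ 4 * t ^ 4 := by nlinarith
    have e3 := mul_le_mul_of_nonneg_left t3 hr
    have e4 := mul_le_mul_of_nonneg_left t4 hr
    have e2 : (r : ℝ) * 1 ≤ r * (16 * t ^ 4) := mul_le_mul_of_nonneg_left (by nlinarith) hr
    rw [abs_le] at h2 ⊢
    constructor <;> nlinarith

end Deterministic

/-! ### Fourth moment of the Gaussian spectral norm. -/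

section GaussianOpNorm

open scoped ENNReal

/-- A midpoint-convex function on the unit ball is controlled at a point of norm at most `1 / 2` by
its average over the ball, up to a factor `2 ^ n`. -/
theorem mul_volume_ball_le_lintegral {n : ℕ} (g : EuclideanSpace ℝ (Fin n) → ℝ≥0∞)
    (hg : Measurable g) (c : EuclideanSpace ℝ (Fin n)) (hc : ‖c‖ ≤ 1 / 2)
    (h : ∀ a, 2 * g c ≤ g (c + a) + g (c - a)) :
    g c * volume (Metric.ball (0 : EuclideanSpace ℝ (Fin n)) 1) ≤
      2 ^ n * ∫⁻ x in Metric.ball 0 1, g x := by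
  -- The ball of radius 1/2 around `c` lies in the unit ball and is symmetric about `c`. Integrating
  -- the midpoint inequality over it costs only the volume ratio `2 ^ n`.
  set G := (Metric.ball c (1 / 2)).indicator g with hG
  have hGint : ∫⁻ x, G x ≤ ∫⁻ x in Metric.ball 0 1, g x := by
    rw [hG, lintegral_indicator Metric.isOpen_ball.measurableSet]
    refine lintegral_mono_set (Metric.ball_subset_ball' ?_)
    rw [dist_zero_right]; linarith
  have h1 : ∫⁻ a, G (c + a) = ∫⁻ x, G x := lintegral_add_left_eq_self G c
  have h2 : ∫⁻ a, G (c - a) = ∫⁻ x, G x := lintegral_sub_left_eq_self G c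
  have hGm : Measurable G := hg.indicator Metric.isOpen_ball.measurableSet
  have h3 : 2 * (g c * volume (Metric.ball (0 : EuclideanSpace ℝ (Fin n)) (1 / 2))) ≤
      2 * ∫⁻ x, G x := by
    calc _ = ∫⁻ a in Metric.ball (0 : EuclideanSpace ℝ (Fin n)) (1 / 2), 2 * g c := by
          rw [setLIntegral_const, mul_assoc]
      _ ≤ ∫⁻ a in Metric.ball (0 : EuclideanSpace ℝ (Fin n)) (1 / 2), (G (c + a) + G (c - a)) := by
          refine setLIntegral_mono' Metric.isOpen_ball.measurableSet fun a ha => ?_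
          have ha' : ‖a‖ < 1 / 2 := by simpa using ha
          rw [hG, Set.indicator_of_mem (by simpa [dist_eq_norm] using ha'),
            Set.indicator_of_mem (by simpa [dist_eq_norm] using ha')]
          exact h a
      _ ≤ ∫⁻ a, (G (c + a) + G (c - a)) := setLIntegral_le_lintegral _ _
      _ = 2 * ∫⁻ x, G x := by
          rw [lintegral_add_left (f := fun a => G (c + a)) (hGm.comp (measurable_const_add c)), h1, h2, two_mul]
  have h4 : g c * volume (Metric.ball (0 : EuclideanSpace ℝ (Fin n)) (1 / 2)) ≤ ∫⁻ x, G x :=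
    (ENNReal.mul_le_mul_iff_right (by norm_num) (by norm_num)).1 h3
  have h5 : (2 : ℝ≥0∞) ^ n * volume (Metric.ball (0 : EuclideanSpace ℝ (Fin n)) (1 / 2)) =
      volume (Metric.ball (0 : EuclideanSpace ℝ (Fin n)) 1) := by
    rw [Measure.addHaar_ball_of_pos _ _ (by norm_num : (0 : ℝ) < 1 / 2), finrank_euclideanSpace,
      Fintype.card_fin, ← mul_assoc, ENNReal.ofReal_pow (by norm_num), ← mul_pow]
    have : (2 : ℝ≥0∞) * ENNReal.ofReal (1 / 2) = 1 := by
      rw [← ENNReal.ofReal_ofNat 2, ← ENNReal.ofReal_mul (by norm_num)]; norm_num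
    rw [this, one_pow, one_mul]
  calc _ = 2 ^ n * (g c * volume (Metric.ball (0 : EuclideanSpace ℝ (Fin n)) (1 / 2))) := by
        rw [← h5]; ring
    _ ≤ _ := by gcongr; exact h4.trans hGint

theorem two_mul_ofReal_exp_le (a b : ℝ) :
    2 * ENNReal.ofReal (Real.exp a) ≤
      ENNReal.ofReal (Real.exp (a + b)) + ENNReal.ofReal (Real.exp (a - b)) := by
  rw [← ENNReal.ofReal_ofNat 2, ← ENNReal.ofReal_mul (by norm_num),
    ← ENNReal.ofReal_add (by positivity) (by positivity)]
  refine ENNReal.ofReal_le_ofReal ?_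
  have h1 := Real.add_one_le_exp b
  have h2 := Real.add_one_le_exp (-b)
  rw [sub_eq_add_neg, Real.exp_add, Real.exp_add]
  nlinarith [Real.exp_pos a]

variable {m n : ℕ}

/-- The bilinear form of the matrix with entries `z`. -/
noncomputable def bilin (z : Fin m × Fin n → ℝ) (x : EuclideanSpace ℝ (Fin m))
    (y : EuclideanSpace ℝ (Fin n)) : ℝ :=
  ∑ p, x p.1 * y p.2 * z p

theorem bilin_add_left (z : Fin m × Fin n → ℝ) (x x' : EuclideanSpace ℝ (Fin m))
    (y : EuclideanSpace ℝ (Fin n)) : bilin z (x + x') y = bilin z x y + bilin z x' y := by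
  simp [bilin, add_mul, Finset.sum_add_distrib]

theorem bilin_sub_left (z : Fin m × Fin n → ℝ) (x x' : EuclideanSpace ℝ (Fin m))
    (y : EuclideanSpace ℝ (Fin n)) : bilin z (x - x') y = bilin z x y - bilin z x' y := by
  simp [bilin, sub_mul, Finset.sum_sub_distrib]

theorem bilin_add_right (z : Fin m × Fin n → ℝ) (x : EuclideanSpace ℝ (Fin m))
    (y y' : EuclideanSpace ℝ (Fin n)) : bilin z x (y + y') = bilin z x y + bilin z x y' := by
  simp [bilin, add_mul, mul_add, Finset.sum_add_distrib]

theorem bilin_sub_right (z : Fin m × Fin n → ℝ) (x : EuclideanSpace ℝ (Fin m))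
    (y y' : EuclideanSpace ℝ (Fin n)) : bilin z x (y - y') = bilin z x y - bilin z x y' := by
  simp [bilin, sub_mul, mul_sub, Finset.sum_sub_distrib]

theorem continuous_bilin : Continuous (fun w : (Fin m × Fin n → ℝ) ×
    (EuclideanSpace ℝ (Fin m) × EuclideanSpace ℝ (Fin n)) => bilin w.1 w.2.1 w.2.2) := by
  unfold bilin; fun_prop

theorem bilin_eq_dotProduct (z : Fin m × Fin n → ℝ) (x : EuclideanSpace ℝ (Fin m))
    (y : EuclideanSpace ℝ (Fin n)) :
    bilin z x y = x.ofLp ⬝ᵥ (Matrix.of (fun i j => z (i, j)) *ᵥ y.ofLp) := by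
  simp only [bilin, Fintype.sum_prod_type, dotProduct, mulVec, of_apply, Finset.mul_sum]
  exact Finset.sum_congr rfl fun i _ => Finset.sum_congr rfl fun j _ => by ring

/-- Two-variable version of `mul_volume_ball_le_lintegral`. -/
theorem mul_volume_ball_prod_le_lintegral
    (F : EuclideanSpace ℝ (Fin m) × EuclideanSpace ℝ (Fin n) → ℝ≥0∞) (hF : Measurable F)
    (u : EuclideanSpace ℝ (Fin m)) (v : EuclideanSpace ℝ (Fin n)) (hu : ‖u‖ ≤ 1 / 2)
    (hv : ‖v‖ ≤ 1 / 2) (h1 : ∀ a, 2 * F (u, v) ≤ F (u + a, v) + F (u - a, v))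
    (h2 : ∀ x a, 2 * F (x, v) ≤ F (x, v + a) + F (x, v - a)) :
    F (u, v) * (volume (Metric.ball (0 : EuclideanSpace ℝ (Fin m)) 1) *
        volume (Metric.ball (0 : EuclideanSpace ℝ (Fin n)) 1)) ≤
      2 ^ (m + n) * ∫⁻ p, F p
        ∂((volume.restrict (Metric.ball (0 : EuclideanSpace ℝ (Fin m)) 1)).prod
          (volume.restrict (Metric.ball (0 : EuclideanSpace ℝ (Fin n)) 1))) := by
  have hFv : Measurable fun x => F (x, v) := hF.comp (measurable_id.prodMk measurable_const)
  -- Averaging in the first variable comes first; the second inequality is then needed at every `x`.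
  have k1 := mul_volume_ball_le_lintegral (fun x => F (x, v)) hFv u hu h1
  have k2 (x : EuclideanSpace ℝ (Fin m)) := mul_volume_ball_le_lintegral (fun y => F (x, y))
    (hF.comp (measurable_const.prodMk measurable_id)) v hv (h2 x)
  rw [lintegral_prod _ hF.aemeasurable, ← mul_assoc]
  refine (mul_le_mul_left k1 _).trans ?_
  rw [mul_assoc, pow_add, mul_assoc]
  refine mul_le_mul_right ?_ _
  rw [← lintegral_mul_const _ hFv, ← lintegral_const_mul _ hF.lintegral_prod_right']
  exact lintegral_mono k2

theorem exp_bilin_mul_volume_le (t : ℝ) (z : Fin m × Fin n → ℝ) (u : EuclideanSpace ℝ (Fin m))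
    (v : EuclideanSpace ℝ (Fin n)) (hu : ‖u‖ ≤ 1 / 2) (hv : ‖v‖ ≤ 1 / 2) :
    ENNReal.ofReal (Real.exp (t * bilin z u v)) *
      (volume (Metric.ball (0 : EuclideanSpace ℝ (Fin m)) 1) *
        volume (Metric.ball (0 : EuclideanSpace ℝ (Fin n)) 1)) ≤
      2 ^ (m + n) * ∫⁻ p, ENNReal.ofReal (Real.exp (t * bilin z p.1 p.2))
        ∂((volume.restrict (Metric.ball (0 : EuclideanSpace ℝ (Fin m)) 1)).prod
          (volume.restrict (Metric.ball (0 : EuclideanSpace ℝ (Fin n)) 1))) := by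
  have hcont : Continuous fun p : EuclideanSpace ℝ (Fin m) × EuclideanSpace ℝ (Fin n) =>
      bilin z p.1 p.2 := continuous_bilin.comp (by fun_prop : Continuous fun p => (z, p))
  refine mul_volume_ball_prod_le_lintegral
    (fun p => ENNReal.ofReal (Real.exp (t * bilin z p.1 p.2)))
    (Real.continuous_exp.comp (hcont.const_mul t)).measurable.ennreal_ofReal u v hu hv
    (fun a => ?_) (fun x a => ?_)
  · dsimp only
    rw [bilin_add_left, bilin_sub_left, mul_add, mul_sub]; exact two_mul_ofReal_exp_le _ _
  · dsimp only
    rw [bilin_add_right, bilin_sub_right, mul_add, mul_sub]; exact two_mul_ofReal_exp_le _ _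

/-- The pair maximizes the form on balls of radius 1/2, the radius required by the averaging bound.
Rescaling both unit vectors to length 1/2 costs the factor 4. -/
theorem exists_opNorm_le_bilin (z : Fin m × Fin n → ℝ) :
    ∃ (u : EuclideanSpace ℝ (Fin m)) (v : EuclideanSpace ℝ (Fin n)), ‖u‖ ≤ 1 / 2 ∧ ‖v‖ ≤ 1 / 2 ∧
      opNorm (Matrix.of (fun i j => z (i, j))) ≤ 4 * bilin z u v := by
  have hcont : Continuous fun p : EuclideanSpace ℝ (Fin m) × EuclideanSpace ℝ (Fin n) =>
      bilin z p.1 p.2 := continuous_bilin.comp (by fun_prop : Continuous fun p => (z, p))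
  obtain ⟨⟨u, v⟩, huv, hmax⟩ := ((isCompact_closedBall (0 : EuclideanSpace ℝ (Fin m)) (1 / 2)).prod
    (isCompact_closedBall (0 : EuclideanSpace ℝ (Fin n)) (1 / 2))).exists_isMaxOn
    ⟨(0, 0), by simp⟩ hcont.continuousOn
  rw [Set.mem_prod, mem_closedBall_zero_iff, mem_closedBall_zero_iff] at huv
  have hle (x : EuclideanSpace ℝ (Fin m)) (y : EuclideanSpace ℝ (Fin n)) (hx : ‖x‖ ≤ 1 / 2)
      (hy : ‖y‖ ≤ 1 / 2) : bilin z x y ≤ bilin z u v :=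
    hmax (by simp only [Set.mem_prod, mem_closedBall_zero_iff]; exact ⟨hx, hy⟩ :
      (x, y) ∈ Metric.closedBall 0 (1 / 2) ×ˢ Metric.closedBall 0 (1 / 2))
  refine ⟨u, v, huv.1, huv.2, ?_⟩
  have h0 : 0 ≤ bilin z u v := by simpa [bilin] using hle 0 0 (by simp) (by simp)
  refine ContinuousLinearMap.opNorm_le_bound _ (by positivity) fun x => ?_
  set y := (toEuclideanLin (Matrix.of fun i j => z (i, j))) x with hy
  change ‖y‖ ≤ _
  rcases eq_or_ne x 0 with rfl | hx
  · simp [hy]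
  rcases eq_or_ne y 0 with h | hy0
  · rw [h, norm_zero]; positivity
  have hxn := norm_pos_iff.2 hx
  have hyn := norm_pos_iff.2 hy0
  have key := hle ((2 * ‖y‖)⁻¹ • y) ((2 * ‖x‖)⁻¹ • x)
    (by rw [norm_smul, Real.norm_of_nonneg (by positivity)]; apply le_of_eq; field_simp)
    (by rw [norm_smul, Real.norm_of_nonneg (by positivity)]; apply le_of_eq; field_simp)
  have hyy : y.ofLp ⬝ᵥ (Matrix.of (fun i j => z (i, j)) *ᵥ x.ofLp) = ‖y‖ ^ 2 := by
    rw [EuclideanSpace.real_norm_sq_eq]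
    simp [hy, dotProduct, sq]
  rw [bilin_eq_dotProduct, WithLp.ofLp_smul, WithLp.ofLp_smul, mulVec_smul, smul_dotProduct,
    dotProduct_smul, hyy, smul_eq_mul, smul_eq_mul] at key
  have e : (2 * ‖y‖)⁻¹ * ((2 * ‖x‖)⁻¹ * ‖y‖ ^ 2) = ‖y‖ / (4 * ‖x‖) := by field_simp; norm_num
  rw [e, div_le_iff₀ (by positivity)] at key
  linarith

/-- The law of the entries of a standard Gaussian matrix. -/
noncomputable abbrev gaussianEntries (m n : ℕ) : Measure (Fin m × Fin n → ℝ) :=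
  Measure.pi fun _ => gaussianReal 0 1

theorem lintegral_exp_bilin (t : ℝ) (x : EuclideanSpace ℝ (Fin m))
    (y : EuclideanSpace ℝ (Fin n)) :
    ∫⁻ z, ENNReal.ofReal (Real.exp (t * bilin z x y)) ∂(gaussianEntries m n) =
      ENNReal.ofReal (Real.exp (t ^ 2 / 2 * (‖x‖ ^ 2 * ‖y‖ ^ 2))) := by
  have e (z : Fin m × Fin n → ℝ) : Real.exp (t * bilin z x y) =
      ∏ p, Real.exp (t * x p.1 * y p.2 * z p) := by
    rw [← Real.exp_sum, bilin, Finset.mul_sum]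
    congr 1; exact Finset.sum_congr rfl fun p _ => by ring
  simp_rw [e]
  rw [← ofReal_integral_eq_lintegral_ofReal
    (Integrable.fintype_prod (f := fun (p : Fin m × Fin n) (w : ℝ) =>
      Real.exp (t * x p.1 * y p.2 * w)) fun p => integrable_exp_mul_gaussianReal _)
    (Filter.Eventually.of_forall fun z => by positivity)]
  congr 1
  rw [integral_fintype_prod_eq_prod (f := fun (p : Fin m × Fin n) (w : ℝ) =>
      Real.exp (t * x p.1 * y p.2 * w))]
  have hm (c : ℝ) : ∫ w, Real.exp (c * w) ∂(gaussianReal 0 1) = Real.exp (c ^ 2 / 2) := by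
    have := mgf_gaussianReal (p := gaussianReal 0 1) (X := id) (μ := 0) (v := 1) (by simp) c
    simpa [mgf] using this
  simp_rw [hm]
  rw [← Real.exp_sum]
  congr 1
  rw [EuclideanSpace.real_norm_sq_eq, EuclideanSpace.real_norm_sq_eq, Finset.sum_mul_sum,
    ← Fintype.sum_prod_type', Finset.mul_sum]
  exact Finset.sum_congr rfl fun p _ => by ring

/-- `‖Z‖ / 4` is at most the form at some `(u, v)` depending on `Z`. The average over unit balls
removes this dependence, Tonelli exchanges the integrals, and the Gaussian moment generating
function is at most `exp (t² / 2)` for fixed vectors in the balls. -/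
theorem lintegral_exp_opNorm_le {t : ℝ} (ht : 0 ≤ t) :
    ∫⁻ z, ENNReal.ofReal (Real.exp (t / 4 * opNorm (Matrix.of (fun i j => z (i, j)))))
      ∂(gaussianEntries m n) ≤ 2 ^ (m + n) * ENNReal.ofReal (Real.exp (t ^ 2 / 2)) := by
  set Bm := Metric.ball (0 : EuclideanSpace ℝ (Fin m)) 1
  set Bn := Metric.ball (0 : EuclideanSpace ℝ (Fin n)) 1
  set K := volume Bm * volume Bn with hK
  have hK0 : K ≠ 0 := mul_ne_zero (Metric.measure_ball_pos _ _ one_pos).ne'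
    (Metric.measure_ball_pos _ _ one_pos).ne'
  have hKt : K ≠ ∞ := ENNReal.mul_ne_top measure_ball_lt_top.ne measure_ball_lt_top.ne
  set ν := (volume.restrict Bm).prod (volume.restrict Bn) with hν
  have hmeas : Measurable fun w : (Fin m × Fin n → ℝ) ×
      (EuclideanSpace ℝ (Fin m) × EuclideanSpace ℝ (Fin n)) =>
      ENNReal.ofReal (Real.exp (t * bilin w.1 w.2.1 w.2.2)) :=
    (Real.continuous_exp.comp (continuous_bilin.const_mul t)).measurable.ennreal_ofReal
  have h1 (z : Fin m × Fin n → ℝ) :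
      ENNReal.ofReal (Real.exp (t / 4 * opNorm (Matrix.of (fun i j => z (i, j))))) * K ≤
        2 ^ (m + n) * ∫⁻ p, ENNReal.ofReal (Real.exp (t * bilin z p.1 p.2)) ∂ν := by
    obtain ⟨u, v, hu, hv, h⟩ := exists_opNorm_le_bilin z
    refine le_trans ?_ (exp_bilin_mul_volume_le t z u v hu hv)
    exact mul_le_mul_left
      (ENNReal.ofReal_le_ofReal (Real.exp_le_exp.2 (by nlinarith))) _
  have h2 : (∫⁻ z, ENNReal.ofReal (Real.exp (t / 4 * opNorm (Matrix.of (fun i j => z (i, j)))))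
      ∂(gaussianEntries m n)) * K ≤
      2 ^ (m + n) * (ENNReal.ofReal (Real.exp (t ^ 2 / 2)) * K) := by
    rw [← lintegral_mul_const' _ _ hKt]
    refine (lintegral_mono h1).trans ?_
    rw [lintegral_const_mul _ hmeas.lintegral_prod_right']
    gcongr
    rw [lintegral_lintegral_swap hmeas.aemeasurable]
    simp_rw [lintegral_exp_bilin]
    have hνu : ν = (volume.prod volume).restrict (Bm ×ˢ Bn) := by
      rw [hν, Measure.prod_restrict]
    calc _ ≤ ∫⁻ _p, ENNReal.ofReal (Real.exp (t ^ 2 / 2)) ∂ν := by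
          rw [hνu]
          refine setLIntegral_mono' (Metric.isOpen_ball.measurableSet.prod
            Metric.isOpen_ball.measurableSet) fun p hp => ?_
          have hp1 : ‖p.1‖ < 1 := mem_ball_zero_iff.1 hp.1
          have hp2 : ‖p.2‖ < 1 := mem_ball_zero_iff.1 hp.2
          gcongr
          refine mul_le_of_le_one_right (by positivity) ?_
          exact mul_le_one₀ (pow_le_one₀ (norm_nonneg _) hp1.le) (by positivity)
            (pow_le_one₀ (norm_nonneg _) hp2.le)
      _ = ENNReal.ofReal (Real.exp (t ^ 2 / 2)) * K := by
          rw [lintegral_const, hνu, Measure.restrict_apply_univ, Measure.prod_prod]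
  rw [← mul_assoc (2 ^ (m + n))] at h2
  exact (ENNReal.mul_le_mul_iff_left hK0 hKt).1 h2

/-- For `s ≥ 10`, `s⁴ ≤ 8 ((s - 10)⁴ + 10⁴)` and `(s - 10)⁴ ≤ 24 exp (s - 10)`, which explains 80000
and 192 = 8 · 24. -/
theorem pow_four_le_exp {s d : ℝ} (hs : 0 ≤ s) (hd : 1 ≤ d) :
    s ^ 4 ≤ 80000 + 192 * Real.exp (d * s - 10 * d) := by
  have hpos := Real.exp_pos (d * s - 10 * d)
  rcases le_total s 10 with h | h
  · have : s ^ 4 ≤ 10 ^ 4 := pow_le_pow_left₀ hs h 4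
    linarith
  · have h1 := Real.pow_div_factorial_le_exp (s - 10) (by linarith) 4
    have h2 : Real.exp (s - 10) ≤ Real.exp (d * s - 10 * d) := Real.exp_le_exp.2 (by nlinarith)
    norm_num [Nat.factorial] at h1
    nlinarith [sq_nonneg ((s - 10) ^ 2 - 100), sq_nonneg (s - 20), sq_nonneg ((s - 20) * s),
      sq_nonneg ((s - 20) * (s - 10)), sq_nonneg ((s - 10) - 10)]

theorem continuous_opNorm_of :
    Continuous fun z : Fin m × Fin n → ℝ => opNorm (Matrix.of (fun i j => z (i, j))) :=
  continuous_opNorm.comp (continuous_matrix fun i j => continuous_apply (i, j))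

/-- Fourth moment of the spectral norm of a standard Gaussian matrix. -/
theorem integral_opNorm_pow_four_le {d : ℝ} (hd : 1 ≤ d) (hm : (m : ℝ) ≤ d) (hn : (n : ℝ) ≤ d) :
    Integrable (fun z => opNorm (Matrix.of (fun i j => z (i, j))) ^ 4) (gaussianEntries m n) ∧
      ∫ z, opNorm (Matrix.of (fun i j => z (i, j))) ^ 4 ∂(gaussianEntries m n) ≤ 80192 * d ^ 2 := by
  have hd0 : 0 < d := by linarith
  have hsd : 0 < √d := Real.sqrt_pos.2 hd0
  have hsq : √d * √d = d := Real.mul_self_sqrt hd0.le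
  set f : (Fin m × Fin n → ℝ) → ℝ := fun z =>
    Real.exp (√d * opNorm (Matrix.of (fun i j => z (i, j)))) with hf
  have hfc : Continuous f := Real.continuous_exp.comp (continuous_opNorm_of.const_mul _)
  have hl : ∫⁻ z, ENNReal.ofReal (f z) ∂(gaussianEntries m n) ≤
      ENNReal.ofReal (Real.exp (10 * d)) := by
    -- With `t = 4 √d`, the Gaussian factor is `exp (8 d)`, and `2 ^ (m + n) ≤ exp (2 d)`. Together
    -- they give the exponent `10 d` that `pow_four_le_exp` subtracts.
    have := lintegral_exp_opNorm_le (m := m) (n := n) (t := 4 * √d) (by positivity)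
    rw [mul_div_cancel_left₀ _ (by norm_num : (4 : ℝ) ≠ 0)] at this
    refine this.trans ?_
    rw [← ENNReal.ofReal_ofNat 2, ← ENNReal.ofReal_pow (by norm_num),
      ← ENNReal.ofReal_mul (by positivity)]
    refine ENNReal.ofReal_le_ofReal ?_
    have h2 : (2 : ℝ) ≤ Real.exp 1 := by have := Real.add_one_le_exp (1 : ℝ); linarith
    calc (2 : ℝ) ^ (m + n) * Real.exp ((4 * √d) ^ 2 / 2)
        ≤ Real.exp 1 ^ (m + n) * Real.exp (8 * d) := by
          gcongr
          nlinarith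
      _ = Real.exp (m + n + 8 * d) := by
          rw [← Real.exp_nat_mul, ← Real.exp_add]; push_cast; ring_nf
      _ ≤ Real.exp (10 * d) := Real.exp_le_exp.2 (by linarith)
  have hfi : Integrable f (gaussianEntries m n) := by
    refine ⟨hfc.aestronglyMeasurable, ?_⟩
    rw [hasFiniteIntegral_iff_ofReal (Filter.Eventually.of_forall fun z => (Real.exp_pos _).le)]
    exact hl.trans_lt ENNReal.ofReal_lt_top
  have hfl : ∫ z, f z ∂(gaussianEntries m n) ≤ Real.exp (10 * d) := by
    rw [integral_eq_lintegral_of_nonneg_ae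
      (Filter.Eventually.of_forall fun z => (Real.exp_pos _).le) hfc.aestronglyMeasurable]
    exact ENNReal.toReal_le_of_le_ofReal (Real.exp_pos _).le hl
  have hb (z : Fin m × Fin n → ℝ) : opNorm (Matrix.of (fun i j => z (i, j))) ^ 4 ≤
      d ^ 2 * (80000 + 192 * (Real.exp (-(10 * d)) * f z)) := by
    have h := pow_four_le_exp
      (div_nonneg (opNorm_nonneg (Matrix.of (fun i j => z (i, j)))) hsd.le) hd
    have e1 : d * (opNorm (Matrix.of (fun i j => z (i, j))) / √d) =
        √d * opNorm (Matrix.of (fun i j => z (i, j))) := by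
      rw [mul_div_assoc', div_eq_iff hsd.ne']
      linear_combination -opNorm (Matrix.of (fun i j => z (i, j))) * hsq
    have e2 : √d ^ 4 = d ^ 2 := by
      rw [show √d ^ 4 = (√d * √d) ^ 2 by ring, hsq]
    rw [e1, div_pow, e2, div_le_iff₀ (by positivity), sub_eq_neg_add, Real.exp_add] at h
    linarith
  have hgi : Integrable (fun z => d ^ 2 * (80000 + 192 * (Real.exp (-(10 * d)) * f z)))
      (gaussianEntries m n) :=
    ((integrable_const _).add ((hfi.const_mul _).const_mul _)).const_mul _
  have hi : Integrable (fun z => opNorm (Matrix.of (fun i j => z (i, j))) ^ 4)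
      (gaussianEntries m n) :=
    hgi.mono' (continuous_opNorm_of.pow 4).aestronglyMeasurable
      (Filter.Eventually.of_forall fun z => by
        rw [Real.norm_of_nonneg (pow_nonneg (opNorm_nonneg _) 4)]; exact hb z)
  refine ⟨hi, (integral_mono hi hgi hb).trans ?_⟩
  rw [integral_const_mul, integral_add (integrable_const _) ((hfi.const_mul _).const_mul _),
    integral_const_mul, integral_const_mul]
  have h1 : Real.exp (-(10 * d)) * ∫ z, f z ∂(gaussianEntries m n) ≤ 1 := by
    calc _ ≤ Real.exp (-(10 * d)) * Real.exp (10 * d) := by gcongr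
      _ = 1 := by rw [← Real.exp_add]; simp
  simp only [integral_const, probReal_univ, smul_eq_mul, one_mul]
  nlinarith [sq_nonneg d]

end GaussianOpNorm

/-! ### Means of the quadratic and cubic terms. -/

section GaussianMoments

variable {m n r : ℕ}

theorem memLp_eval_gaussianEntries (p : Fin m × Fin n) :
    MemLp (fun z : Fin m × Fin n → ℝ => z p) 2 (gaussianEntries m n) :=
  (memLp_id_gaussianReal' 2 (by norm_num)).comp_measurePreserving
    (measurePreserving_eval (fun _ : Fin m × Fin n => gaussianReal 0 1) p)

theorem integrable_mul_gaussianEntries (p q : Fin m × Fin n) :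
    Integrable (fun z : Fin m × Fin n → ℝ => z p * z q) (gaussianEntries m n) :=
  (memLp_eval_gaussianEntries p).integrable_mul (memLp_eval_gaussianEntries q)

theorem integral_mul_gaussianEntries (p q : Fin m × Fin n) :
    ∫ z, z p * z q ∂(gaussianEntries m n) = if p = q then 1 else 0 := by
  split_ifs with h
  · subst h
    rw [integral_comp_eval (μ := fun _ : Fin m × Fin n => gaussianReal 0 1) (i := p)
      (f := fun w : ℝ => w * w) (by fun_prop)]
    have h1 := variance_fun_id_gaussianReal (μ := 0) (v := 1)
    rw [variance_of_integral_eq_zero (by fun_prop) (by simp)] at h1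
    simpa [sq] using h1
  · have hind := (iIndepFun_pi (μ := fun _ : Fin m × Fin n => gaussianReal 0 1)
      (X := fun _ w => w) (fun _ => aemeasurable_id)).indepFun h
    rw [hind.integral_fun_mul_eq_mul_integral (measurable_pi_apply p).aestronglyMeasurable
      (measurable_pi_apply q).aestronglyMeasurable]
    rw [integral_comp_eval (μ := fun _ : Fin m × Fin n => gaussianReal 0 1) (i := p)
      (f := fun w : ℝ => w) (by fun_prop), integral_id_gaussianReal, zero_mul]

theorem integral_sum_mul_sq_gaussianEntries (c : Fin m × Fin n → ℝ) :
    Integrable (fun z => (∑ p, c p * z p) ^ 2) (gaussianEntries m n) ∧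
      ∫ z, (∑ p, c p * z p) ^ 2 ∂(gaussianEntries m n) = ∑ p, c p ^ 2 := by
  have e (z : Fin m × Fin n → ℝ) :
      (∑ p, c p * z p) ^ 2 = ∑ p, ∑ q, c p * c q * (z p * z q) := by
    rw [sq, Finset.sum_mul_sum]
    exact Finset.sum_congr rfl fun p _ => Finset.sum_congr rfl fun q _ => by ring
  have hi (p q : Fin m × Fin n) :
      Integrable (fun z => c p * c q * (z p * z q)) (gaussianEntries m n) :=
    (integrable_mul_gaussianEntries p q).const_mul _
  simp_rw [e]
  refine ⟨integrable_finsetSum _ fun p _ => integrable_finsetSum _ fun q _ => hi p q, ?_⟩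
  rw [integral_finsetSum _ fun p _ => integrable_finsetSum _ fun q _ => hi p q]
  refine Finset.sum_congr rfl fun p _ => ?_
  rw [integral_finsetSum _ fun q _ => hi p q]
  simp_rw [integral_const_mul, integral_mul_gaussianEntries]
  simp [sq]

/-- Each entry of `A Z B` is a linear form in the entries of `Z`, which are orthonormal in `L²`; its
coefficients are products of entries of `A` and `B`. -/
theorem integral_frobenius_mul_mul_sq {α β : Type*} [Fintype α] [Fintype β]
    (A : Matrix α (Fin m) ℝ) (B : Matrix (Fin n) β ℝ) :
    Integrable (fun z => ‖A * Matrix.of (fun i j => z (i, j)) * B‖ ^ 2) (gaussianEntries m n) ∧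
      ∫ z, ‖A * Matrix.of (fun i j => z (i, j)) * B‖ ^ 2 ∂(gaussianEntries m n) =
        ‖A‖ ^ 2 * ‖B‖ ^ 2 := by
  have e (z : Fin m × Fin n → ℝ) : ‖A * Matrix.of (fun i j => z (i, j)) * B‖ ^ 2 =
      ∑ a, ∑ b, (∑ p : Fin m × Fin n, A a p.1 * B p.2 b * z p) ^ 2 := by
    rw [frobenius_sq_eq_sum]
    refine Finset.sum_congr rfl fun a _ => Finset.sum_congr rfl fun b _ => ?_
    congr 1
    rw [Fintype.sum_prod_type_right]
    simp only [Matrix.mul_apply, of_apply, Finset.sum_mul]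
    exact Finset.sum_congr rfl fun j _ => Finset.sum_congr rfl fun i _ => by ring
  have hi (a : α) (b : β) := integral_sum_mul_sq_gaussianEntries
    (fun p : Fin m × Fin n => A a p.1 * B p.2 b)
  simp_rw [e]
  refine ⟨integrable_finsetSum _ fun a _ => integrable_finsetSum _ fun b _ => (hi a b).1, ?_⟩
  rw [integral_finsetSum _ fun a _ => integrable_finsetSum _ fun b _ => (hi a b).1,
    frobenius_sq_eq_sum, Finset.sum_mul]
  refine Finset.sum_congr rfl fun a _ => ?_
  rw [integral_finsetSum _ fun b _ => (hi a b).1]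
  simp_rw [(hi a _).2]
  rw [frobenius_sq_eq_sum, Finset.sum_mul_sum]
  simp_rw [Fintype.sum_prod_type, mul_pow, Finset.mul_sum]
  rw [Finset.sum_comm]
  exact Finset.sum_congr rfl fun i _ => Finset.sum_comm

theorem measurePreserving_neg_gaussianEntries :
    MeasurePreserving (fun z : Fin m × Fin n → ℝ => -z) (gaussianEntries m n)
      (gaussianEntries m n) :=
  measurePreserving_pi (fun _ => gaussianReal 0 1) (fun _ => gaussianReal 0 1)
    (f := fun _ w => -w) fun _ => ⟨measurable_neg, by rw [gaussianReal_map_neg, neg_zero]⟩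

theorem integral_eq_zero_of_odd {F : (Fin m × Fin n → ℝ) → ℝ} (hF : ∀ z, F (-z) = -F z) :
    ∫ z, F z ∂(gaussianEntries m n) = 0 := by
  have h := measurePreserving_neg_gaussianEntries.integral_comp
    (MeasurableEquiv.neg (Fin m × Fin n → ℝ)).measurableEmbedding F
  simp_rw [hF] at h
  rw [integral_neg] at h
  linarith

theorem frobenius_one_sub_sq {U : Matrix (Fin m) (Fin r) ℝ} (hU : Uᵀ * U = 1) :
    ‖1 - U * Uᵀ‖ ^ 2 = (m : ℝ) - r := by
  have h : (1 - U * Uᵀ)ᵀ * (1 - U * Uᵀ) = 1 - U * Uᵀ := by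
    rw [transpose_sub, transpose_one, transpose_mul, transpose_transpose, Matrix.mul_sub,
      Matrix.mul_one, Matrix.sub_mul, Matrix.one_mul, Matrix.mul_assoc, ← Matrix.mul_assoc Uᵀ, hU,
      Matrix.one_mul, sub_self, sub_zero]
  rw [frobenius_sq_eq_trace, h, trace_sub, trace_one, trace_mul_comm, hU, trace_one]
  simp

theorem frobenius_mul_transpose_isometry {l : ℕ} {U : Matrix (Fin m) (Fin r) ℝ}
    (hU : Uᵀ * U = 1) (Y : Matrix (Fin l) (Fin r) ℝ) : ‖Y * Uᵀ‖ = ‖Y‖ := by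
  rw [← frobenius_norm_transpose, transpose_mul, transpose_transpose, frobenius_isometry_mul hU,
    frobenius_norm_transpose]

/-- The product of the three factors is block diagonal. Each block has the form `A Z B` or its
transpose, with one factor a complementary projection, of squared norm `m - r` or `n - r`. -/
theorem frobenius_projPerp_sq_eq {U : Matrix (Fin m) (Fin r) ℝ} {V : Matrix (Fin n) (Fin r) ℝ}
    (lam : Fin r → ℝ) (Z : Matrix (Fin m) (Fin n) ℝ) :
    ‖projPerp U V * symmDilation Z * projInv U V lam‖ ^ 2 =
      ‖(1 - U * Uᵀ) * Z * (V * diagonal (fun i => (lam i)⁻¹) * Uᵀ)‖ ^ 2 +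
        ‖V * diagonal (fun i => (lam i)⁻¹) * Uᵀ * Z * (1 - V * Vᵀ)‖ ^ 2 := by
  have hW : (U * diagonal (fun i => (lam i)⁻¹) * Vᵀ)ᵀ =
      V * diagonal (fun i => (lam i)⁻¹) * Uᵀ := by simp [Matrix.mul_assoc]
  have hV : (1 - V * Vᵀ) * Zᵀ * (U * diagonal (fun i => (lam i)⁻¹) * Vᵀ) =
      (V * diagonal (fun i => (lam i)⁻¹) * Uᵀ * Z * (1 - V * Vᵀ))ᵀ := by
    rw [← hW]
    generalize U * diagonal (fun i => (lam i)⁻¹) * Vᵀ = W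
    simp [Matrix.mul_assoc]
  have h : projPerp U V * symmDilation Z * projInv U V lam =
      fromBlocks ((1 - U * Uᵀ) * Z * (V * diagonal (fun i => (lam i)⁻¹) * Uᵀ)) 0 0
        (V * diagonal (fun i => (lam i)⁻¹) * Uᵀ * Z * (1 - V * Vᵀ))ᵀ := by
    rw [projInv_eq_symmDilation, projPerp, thetaMat_mul_transpose, ← fromBlocks_one,
      fromBlocks_diagonal_sub, ← hV, ← hW]
    simp only [symmDilation, fromBlocks_multiply, Matrix.mul_zero, Matrix.zero_mul, add_zero,
      zero_add]
  rw [h, frobenius_fromBlocks_diagonal_sq, frobenius_norm_transpose]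

theorem integral_frobenius_projPerp_sq {U : Matrix (Fin m) (Fin r) ℝ}
    {V : Matrix (Fin n) (Fin r) ℝ} (hU : Uᵀ * U = 1) (hV : Vᵀ * V = 1) (lam : Fin r → ℝ) :
    Integrable (fun z => ‖projPerp U V * symmDilation (Matrix.of (fun i j => z (i, j))) *
      projInv U V lam‖ ^ 2) (gaussianEntries m n) ∧
    ∫ z, ‖projPerp U V * symmDilation (Matrix.of (fun i j => z (i, j))) *
      projInv U V lam‖ ^ 2 ∂(gaussianEntries m n) =
      ((m : ℝ) + n - 2 * r) * ‖diagonal (fun i => (lam i)⁻¹)‖ ^ 2 := by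
  have h1 := integral_frobenius_mul_mul_sq (1 - U * Uᵀ)
    (V * diagonal (fun i => (lam i)⁻¹) * Uᵀ)
  have h2 := integral_frobenius_mul_mul_sq (V * diagonal (fun i => (lam i)⁻¹) * Uᵀ)
    (1 - V * Vᵀ)
  have h3 : ‖V * diagonal (fun i => (lam i)⁻¹) * Uᵀ‖ = ‖diagonal (fun i => (lam i)⁻¹)‖ := by
    rw [frobenius_mul_transpose_isometry hU, frobenius_isometry_mul hV]
  simp_rw [frobenius_projPerp_sq_eq]
  refine ⟨h1.1.add h2.1, ?_⟩
  rw [integral_add h1.1 h2.1, h1.2, h2.2, h3, frobenius_one_sub_sq hU, frobenius_one_sub_sq hV]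
  ring

theorem continuous_cubicTerm {ι : Type*} [Fintype ι] [DecidableEq ι] (P S : Matrix ι ι ℝ) :
    Continuous (cubicTerm P S) := by
  unfold cubicTerm
  exact (Continuous.norm (by fun_prop)).pow 2 |>.sub ((Continuous.norm (by fun_prop)).pow 2)

theorem continuous_symmDilation_of :
    Continuous fun z : Fin m × Fin n → ℝ => symmDilation (Matrix.of (fun i j => z (i, j))) := by
  have h : Continuous fun z : Fin m × Fin n → ℝ => Matrix.of (fun i j => z (i, j)) :=
    continuous_matrix fun i j => continuous_apply (i, j)
  exact continuous_const.matrix_fromBlocks h h.matrix_transpose continuous_const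

theorem inv_diagonal_eq {lam : Fin r → ℝ} (h : ∀ i, 0 < lam i) :
    (diagonal lam)⁻¹ = diagonal fun i => (lam i)⁻¹ := by
  refine Matrix.inv_eq_right_inv ?_
  rw [diagonal_mul_diagonal, ← diagonal_one]
  congr 1; ext i
  exact mul_inv_cancel₀ (h i).ne'

theorem IsStdGaussianMatrix.hasLaw_entries {Ω : Type*} [MeasurableSpace Ω] {μ : Measure Ω}
    {Z : Ω → Matrix (Fin m) (Fin n) ℝ} (hZ : IsStdGaussianMatrix Z μ) :
    HasLaw (fun ω (p : Fin m × Fin n) => Z ω p.1 p.2) (gaussianEntries m n) μ :=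
  hZ.indep.hasLaw_pi fun p => hZ.hasLaw p.1 p.2

theorem integrable_and_integral_comp_of_hasLaw {Ω Ω' : Type*} [MeasurableSpace Ω]
    [MeasurableSpace Ω'] {μ : Measure Ω} {ν : Measure Ω'} {X : Ω → Ω'} (hX : HasLaw X ν μ)
    {F : Ω' → ℝ} (hF : Integrable F ν) :
    Integrable (fun ω => F (X ω)) μ ∧ ∫ ω, F (X ω) ∂μ = ∫ x, F x ∂ν := by
  refine ⟨?_, hX.integral_comp hF.aestronglyMeasurable⟩
  rw [← hX.map_eq] at hF
  exact hF.comp_aemeasurable hX.aemeasurable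

/-- The cubic term has mean zero. -/
theorem integral_cubicTerm {U : Matrix (Fin m) (Fin r) ℝ} {V : Matrix (Fin n) (Fin r) ℝ}
    {lam : Fin r → ℝ} {l : ℝ} (hU : Uᵀ * U = 1) (hV : Vᵀ * V = 1) (hl0 : 0 < l)
    (hl : ∀ i, l ≤ lam i)
    (hi : Integrable (fun z => opNorm (Matrix.of (fun i j => z (i, j))) ^ 4)
      (gaussianEntries m n)) :
    Integrable (fun z => cubicTerm (thetaMat U V * (thetaMat U V)ᵀ) (projInv U V lam)
      (symmDilation (Matrix.of (fun i j => z (i, j))))) (gaussianEntries m n) ∧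
    ∫ z, cubicTerm (thetaMat U V * (thetaMat U V)ᵀ) (projInv U V lam)
      (symmDilation (Matrix.of (fun i j => z (i, j)))) ∂(gaussianEntries m n) = 0 := by
  constructor
  · refine Integrable.mono' (((integrable_const (1 : ℝ)).add (hi.const_mul (l⁻¹ ^ 4))).const_mul
      (16 * (r : ℝ)))
      ((continuous_cubicTerm _ _).comp continuous_symmDilation_of).aestronglyMeasurable
      (Filter.Eventually.of_forall fun z => ?_)
    refine ((frobenius_projPerp_mul_projInv_le hU hV hl0 hl
      (Matrix.of (fun i j => z (i, j)))).2).trans ?_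
    refine mul_le_mul_of_nonneg_left ?_ (by positivity)
    have ht : 0 ≤ opNorm (Matrix.of (fun i j => z (i, j))) / l :=
      div_nonneg (opNorm_nonneg _) hl0.le
    have e : l⁻¹ ^ 4 * opNorm (Matrix.of (fun i j => z (i, j))) ^ 4 =
        (opNorm (Matrix.of (fun i j => z (i, j))) / l) ^ 4 := by
      rw [div_eq_mul_inv, mul_pow]; ring
    simp only [Pi.add_apply]
    rw [e]
    generalize opNorm (Matrix.of (fun i j => z (i, j))) / l = t at ht
    -- Integrability of the cubic term reduces to the fourth moment through `t³ ≤ 1 + t⁴`.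
    rcases le_total t 1 with h | h
    · have := pow_le_one₀ (n := 3) ht h
      nlinarith [pow_nonneg ht 4]
    · have := pow_le_pow_right₀ h (by norm_num : 3 ≤ 4)
      linarith
  · refine integral_eq_zero_of_odd fun z => ?_
    rw [← cubicTerm_neg, ← symmDilation_neg]
    rfl

end GaussianMoments

/-! ### The main theorem. -/

theorem lemma4p1 :
    ∃ C₁ C₂ : ℝ, 0 < C₁ ∧ 0 < C₂ ∧
      ∀ (d₁ d₂ r : ℕ) (hr : 0 < r)
        (M : Matrix (Fin d₁) (Fin d₂) ℝ) (U : Matrix (Fin d₁) (Fin r) ℝ)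
        (V : Matrix (Fin d₂) (Fin r) ℝ) (lam : Fin r → ℝ)
        (_ : IsSVD M U lam V) (_ : ∀ i, 0 < lam i)
        (Ω : Type*) [MeasurableSpace Ω] (μ : Measure Ω) [IsProbabilityMeasure μ]
        (Z : Ω → Matrix (Fin d₁) (Fin d₂) ℝ) (_ : IsStdGaussianMatrix Z μ),
        (Integrable (fun ω => ‖projPerp U V * symmDilation (Z ω) * projInv U V lam‖ ^ 2) μ ∧
          ∫ ω, ‖projPerp U V * symmDilation (Z ω) * projInv U V lam‖ ^ 2 ∂μ =
            ((d₁ : ℝ) + d₂ - 2 * r) * ‖(diagonal lam)⁻¹‖ ^ 2) ∧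
        (C₁ * Real.sqrt (max (d₁ : ℝ) d₂) ≤ lam ⟨r - 1, Nat.sub_lt hr one_pos⟩ →
          ∀ (Uh : Ω → Matrix (Fin d₁) (Fin r) ℝ) (Vh : Ω → Matrix (Fin d₂) (Fin r) ℝ),
            (∀ i j, AEMeasurable (fun ω => Uh ω i j) μ) →
            (∀ i j, AEMeasurable (fun ω => Vh ω i j) μ) →
            (∀ᵐ ω ∂μ, IsTopSingularVectors (M + Z ω) (Uh ω) (Vh ω)) →
            Integrable (fun ω => distSq (Uh ω) (Vh ω) U V) μ ∧
            |∫ ω, distSq (Uh ω) (Vh ω) U V ∂μ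
                - 2 * ((d₁ : ℝ) + d₂ - 2 * r) * ‖(diagonal lam)⁻¹‖ ^ 2| ≤
              C₂ * r * (max (d₁ : ℝ) d₂ / lam ⟨r - 1, Nat.sub_lt hr one_pos⟩ ^ 2) ^ 2) := by
  -- The second constant is the product of those of `distSq_expansion` and
  -- `integral_opNorm_pow_four_le`.
  refine ⟨1, 500 * 80192, one_pos, by norm_num, ?_⟩
  intro d₁ d₂ r hr M U V lam hM hlam Ω _ μ _ Z hZ
  have hlaw := hZ.hasLaw_entries
  have hmain := integral_frobenius_projPerp_sq hM.left_orthonormal hM.right_orthonormal lam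
  have hquad := integrable_and_integral_comp_of_hasLaw hlaw hmain.1
  rw [hmain.2, ← inv_diagonal_eq hlam] at hquad
  refine ⟨hquad, fun _ Uh Vh hUh hVh hsing => ?_⟩
  set l := lam ⟨r - 1, Nat.sub_lt hr one_pos⟩ with hl_def
  have hl0 : 0 < l := hlam _
  have hl (i : Fin r) : l ≤ lam i :=
    hM.antitone (Fin.mk_le_mk.2 (Nat.le_sub_one_of_lt i.2) : i ≤ ⟨r - 1, Nat.sub_lt hr one_pos⟩)
  set d : ℝ := max (d₁ : ℝ) d₂ with hd_def
  -- An orthonormal column of `U` exists since `r > 0`, which forces `d₁ > 0`.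
  have hd : 1 ≤ d := by
    have h1 : 0 < d₁ := by
      by_contra! h0
      obtain rfl := Nat.le_zero.1 h0
      have := congrFun (congrFun hM.left_orthonormal ⟨0, hr⟩) ⟨0, hr⟩
      simp [Matrix.mul_apply] at this
    exact le_max_of_le_left (by exact_mod_cast h1)
  have hop := integral_opNorm_pow_four_le hd (le_max_left _ _) (le_max_right _ _)
  have hcub := integral_cubicTerm hM.left_orthonormal hM.right_orthonormal hl0 hl hop.1
  have hcub' := integrable_and_integral_comp_of_hasLaw hlaw hcub.1
  have hop' := integrable_and_integral_comp_of_hasLaw hlaw hop.1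
  rw [hcub.2] at hcub'
  have hbound : ∀ᵐ ω ∂μ, ‖distSq (Uh ω) (Vh ω) U V
      - 2 * ‖projPerp U V * symmDilation (Z ω) * projInv U V lam‖ ^ 2
      - cubicTerm (thetaMat U V * (thetaMat U V)ᵀ) (projInv U V lam) (symmDilation (Z ω))‖ ≤
      500 * r * l⁻¹ ^ 4 * opNorm (Z ω) ^ 4 := by
    filter_upwards [hsing] with ω hω
    refine (distSq_expansion hM hl0 hl hω).trans (le_of_eq ?_)
    rw [div_eq_mul_inv, mul_pow]
    ring
  have hdist : Integrable (fun ω => distSq (Uh ω) (Vh ω) U V) μ := by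
    refine Integrable.mono' (integrable_const (8 * (r : ℝ))) ?_ ?_
    · refine AEMeasurable.aestronglyMeasurable ?_
      simp only [distSq, frobenius_sq_eq_sum, Matrix.sub_apply, Matrix.mul_apply, transpose_apply]
      refine AEMeasurable.add ?_ ?_ <;>
      refine Finset.aemeasurable_fun_sum _ fun i _ => Finset.aemeasurable_fun_sum _ fun j _ =>
        AEMeasurable.pow_const (AEMeasurable.sub_const
          (Finset.aemeasurable_fun_sum _ fun k _ => AEMeasurable.mul ?_ ?_) _) _
      exacts [hUh i k, hUh j k, hVh i k, hVh j k]
    · filter_upwards [hsing] with ω hω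
      rw [Real.norm_of_nonneg (by unfold distSq; positivity)]
      exact distSq_le hω.orthonormal.1 hω.orthonormal.2 hM.left_orthonormal hM.right_orthonormal
  refine ⟨hdist, ?_⟩
  -- Subtracting the mean of the quadratic term and the centred cubic term leaves exactly the
  -- integral of the pointwise remainder bounded in `hbound`.
  have hint : ∫ ω, distSq (Uh ω) (Vh ω) U V ∂μ
      - 2 * ((d₁ : ℝ) + d₂ - 2 * r) * ‖(diagonal lam)⁻¹‖ ^ 2 =
      ∫ ω, (distSq (Uh ω) (Vh ω) U V
        - 2 * ‖projPerp U V * symmDilation (Z ω) * projInv U V lam‖ ^ 2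
        - cubicTerm (thetaMat U V * (thetaMat U V)ᵀ) (projInv U V lam) (symmDilation (Z ω))) ∂μ := by
    have hq1 : Integrable
        (fun ω => ‖projPerp U V * symmDilation (Z ω) * projInv U V lam‖ ^ 2) μ := hquad.1
    have hq2 : ∫ ω, ‖projPerp U V * symmDilation (Z ω) * projInv U V lam‖ ^ 2 ∂μ = _ := hquad.2
    have hc1 : Integrable (fun ω => cubicTerm (thetaMat U V * (thetaMat U V)ᵀ) (projInv U V lam)
      (symmDilation (Z ω))) μ := hcub'.1
    have hc2 : ∫ ω, cubicTerm (thetaMat U V * (thetaMat U V)ᵀ) (projInv U V lam)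
      (symmDilation (Z ω)) ∂μ = 0 := hcub'.2
    have hdq : Integrable (fun ω => distSq (Uh ω) (Vh ω) U V
        - 2 * ‖projPerp U V * symmDilation (Z ω) * projInv U V lam‖ ^ 2) μ :=
      hdist.sub (hq1.const_mul 2)
    rw [integral_sub hdq hc1, integral_sub hdist (hq1.const_mul 2),
      integral_const_mul, hq2, hc2]
    ring
  rw [hint]
  have hopi : Integrable (fun ω => opNorm (Z ω) ^ 4) μ := hop'.1
  have hopl : ∫ ω, opNorm (Z ω) ^ 4 ∂μ ≤ 80192 * d ^ 2 := hop'.2.trans_le hop.2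
  refine (norm_integral_le_of_norm_le (hopi.const_mul (500 * r * l⁻¹ ^ 4)) hbound).trans ?_
  rw [integral_const_mul]
  refine (mul_le_mul_of_nonneg_left hopl (by positivity)).trans (le_of_eq ?_)
  rw [div_pow, div_eq_mul_inv]
  ring
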